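/- **Setting.** Let $\xi$ be a random variable with law $P$. For each realization of $\xi$ let $f(\cdot;\xi):\mathbb R^d\to\mathbb R$ be convex and $L$-smooth, i.e. differentiable with $\|\nabla f(w;\xi)-\nabla f(w';\xi)\|\le L\|w-w'\|$ for all $w,w'$, where $L>0$. Let $f(w;\cdot)$ be measurable and $P$-integrable for every $w$, and let $F(w)=\mathbb E[f(w;\xi)]$ be $\mu$-strongly convex with $\mu>0$: $F(w)-F(w')\ge\langle\nabla F(w'),w-w'\rangle+\frac{\mu}{2}\|w-w'\|^2$ for all $w,w'$. Let $w_*$ be the minimizer of $F$, assume $\mathbb E\|\nabla f(w_*;\xi)\|^2<\infty$, and put $N=2\,\mathbb E\|\nabla f(w_*;\xi)\|^2$. **Filters.** Let $D_\xi\subseteq\{1,\dots,d\}$ be the set of positions $i$ for which there is a $w$ with $[\nabla f(w;\xi)]_i\ne0$. Fix an integer $D\ge1$ and, for each $\xi$, a partition of $D_\xi$ (depending measurably on $\xi$) into $d_\xi=\min\{D,|D_\xi|\}$ non-empty sets $S^\xi_u$, each of size $\lfloor|D_\xi|/D\rfloor$ or $\lceil|D_\xi|/D\rceil$. A set of positions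 is identified with the diagonal $0/1$-matrix whose ones are at these positions. **Hogwild! recursion.** Let $\tau:\mathbb N\to\mathbb N$ be a (time-varying) delay. Starting from a random or deterministic $w_0$ with $\mathbb E\|w_0\|^2<\infty$, for $t\ge0$, $$w_{t+1}=w_t-\eta_t\,d_{\xi_t}S^{\xi_t}_{u_t}\nabla f(\hat w_t;\xi_t),\qquad \hat w_t=w_{s}-\sum_{j=s}^{t-1}\eta_j\,d_{\xi_j}\Sigma_{t,j}S^{\xi_j}_{u_j}\nabla f(\hat w_j;\xi_j),\quad s=\max\{t-\tau(t),0\}.$$ The read masks $\Sigma_{t,j}$ are arbitrary random diagonal $0/1$-matrices, so reads and writes may be inconsistent (shared memory is consistent with delay $\tau(t)$). The $\xi_t$ have law $P$; given $\xi_t$, the index $u_t$ is uniform over the $d_{\xi_t}$ filters $S^{\xi_t}_u$ (if $d_{\xi_t}=0$, nothing is updated); and $(\xi_t,u_t)$ is independent of $\mathcal F_t$, the $\sigma$-algebra generated by $w_0$, by $\xi_j,u_j$ for $j<t$, and by the masks $\Sigma_{s,j}$, $s-\tau(s)\le j<s$, of all reads $s\le t$. **Lemma.** Assume that $\tau$ is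 monotonically increasing (non-decreasing), that $\frac{2L\alpha D}{\mu}\le\tau(t)$ for all $t$, and that $$\tau(t)\le\sqrt{t\cdot L(t)}\quad\text{for all sufficiently large }t,\qquad L(t)=\frac1{\ln t}-\frac1{(\ln t)^2}.$$ Let $\eta_t=\frac{\alpha_t}{\mu(t+2\tau(t))}$ with deterministic $\alpha_t$, $12\le\alpha_t\le\alpha$. Then $\hat w_{t+1}$ and $w_{t+1}$ have finite second moments, and $$\mathbb E\|\hat w_{t+1}-w_*\|^2\le\frac{4\alpha^2DN}{\mu^2}\cdot\frac1t+O\!\left(\frac1{t\ln t}\right),$$ and $\mathbb E\|w_{t+1}-w_*\|^2$ satisfies the same bound. Explicitly: for every $R$ there is a constant $C$, depending only on $P$, $f$ (hence on $d,L,\mu,w_*,N$), $D$, $\alpha$, $\tau$ and $R$, such that for all such filters, step sizes and runs with $\mathbb E\|w_0-w_*\|^2\le R$ and for all $t\ge2$ both expectations are at most $\frac{4\alpha^2DN}{\mu^2}\cdot\frac1t+\frac{C}{t\ln t}$. -/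

import Mathlib

open MeasureTheory ProbabilityTheory Filter

noncomputable section

namespace Hogwild

/-- The parameter space `ℝ^d` with its Euclidean norm. -/
abbrev Vec (d : ℕ) : Type := EuclideanSpace ℝ (Fin d)

section Loss

variable {d : ℕ} {Ξ : Type*}

/-- The gradient `∇f(w; ξ)` with respect to `w`. -/
def grad (f : Vec d → Ξ → ℝ) (w : Vec d) (ξ : Ξ) : Vec d :=
  gradient (fun v => f v ξ) w

/-- The objective `F(w) = 𝔼[f(w; ξ)]`, where `ξ` has law `P`. -/
def objective [MeasurableSpace Ξ] (P : Measure Ξ) (f : Vec d → Ξ → ℝ) (w : Vec d) : ℝ :=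
  ∫ ξ, f w ξ ∂P

/-- `μ`-strong convexity of a function `F`. -/
def IsStronglyConvex (F : Vec d → ℝ) (μ : ℝ) : Prop :=
  ∀ w w' : Vec d,
    F w - F w' ≥ inner ℝ (gradient F w') (w - w') + μ / 2 * ‖w - w'‖ ^ 2

/-- Every realization `f(·; ξ)` is `L`-smooth. -/
def IsSmoothLoss (f : Vec d → Ξ → ℝ) (L : ℝ) : Prop :=
  ∀ ξ, Differentiable ℝ (fun w => f w ξ) ∧
    ∀ w w' : Vec d, ‖grad f w ξ - grad f w' ξ‖ ≤ L * ‖w - w'‖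

/-- Every realization `f(·; ξ)` is convex. -/
def IsConvexLoss (f : Vec d → Ξ → ℝ) : Prop :=
  ∀ ξ, ∀ w w' : Vec d, f w ξ - f w' ξ ≥ inner ℝ (grad f w' ξ) (w - w')

/-- The constant `N = 2 𝔼[‖∇f(w_*; ξ)‖²]`. -/
def noise [MeasurableSpace Ξ] (P : Measure Ξ) (f : Vec d → Ξ → ℝ) (wstar : Vec d) : ℝ :=
  2 * ∫ ξ, ‖grad f wstar ξ‖ ^ 2 ∂P

/-- `D_ξ`: the positions at which `∇f(w; ξ)` is non-zero for some `w`. -/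
def gradSupport (f : Vec d → Ξ → ℝ) (ξ : Ξ) : Set (Fin d) :=
  {i | ∃ w : Vec d, grad f w ξ i ≠ 0}

/-- `d_ξ`: the number of filters into which `D_ξ` is partitioned. It is `D` if `D ≤ |D_ξ|`, and
`|D_ξ|` otherwise (only non-empty filters are used). -/
def numFilters (f : Vec d → Ξ → ℝ) (D : ℕ) (ξ : Ξ) : ℕ :=
  min D (gradSupport f ξ).ncard

/-- The sets `S^ξ_u`, `u < d_ξ`, are non-empty and partition `D_ξ` into `d_ξ` sets of
size `⌊|D_ξ|/D⌋` or `⌈|D_ξ|/D⌉`. (The sets `S^ξ_u` with `u ≥ d_ξ` are never used.) -/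
structure IsFilterFamily [MeasurableSpace Ξ] (f : Vec d → Ξ → ℝ) (D : ℕ)
    (S : Ξ → ℕ → Set (Fin d)) : Prop where
  measurable : ∀ u, Measurable (fun ξ => S ξ u)
  nonempty : ∀ ξ, ∀ u < numFilters f D ξ, (S ξ u).Nonempty
  disjoint : ∀ ξ, (Set.Iio (numFilters f D ξ)).PairwiseDisjoint (S ξ)
  union : ∀ ξ, ⋃ u ∈ Set.Iio (numFilters f D ξ), S ξ u = gradSupport f ξ
  size : ∀ ξ, ∀ u < numFilters f D ξ,
    (S ξ u).ncard = ⌊((gradSupport f ξ).ncard : ℝ) / D⌋₊ ∨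
    (S ξ u).ncard = ⌈((gradSupport f ξ).ncard : ℝ) / D⌉₊

end Loss

/-- The product of the diagonal 0/1-matrix, whose 1s are at the positions in `A`, with `v`. -/
def mask {d : ℕ} (A : Set (Fin d)) (v : Vec d) : Vec d :=
  WithLp.toLp 2 (A.indicator (fun i => v i))

section Run

variable {d : ℕ} {Ω Ξ : Type*} [MeasurableSpace Ω] [MeasurableSpace Ξ]

/-- The σ-algebra `𝓕_t` generated by the initial vector, by the samples and filter indices of the
steps before `t`, and by the read masks `Σ_{s,j}` of all the reads up to and including that of
`ŵ_t`. -/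
abbrev history (τ : ℕ → ℕ) (w₀ : Ω → Vec d) (ξ : ℕ → Ω → Ξ) (u : ℕ → Ω → ℕ)
    (Sig : ℕ → ℕ → Ω → Set (Fin d)) (t : ℕ) : MeasurableSpace Ω :=
  MeasurableSpace.comap w₀ inferInstance ⊔
  (⨆ j ∈ Finset.range t, MeasurableSpace.comap (fun ω => (ξ j ω, u j ω)) inferInstance) ⊔
  (⨆ s ∈ Finset.range (t + 1), ⨆ j ∈ Finset.Ico (s - τ s) s,
    MeasurableSpace.comap (Sig s j) inferInstance)

/-- A run `(w_t, ŵ_t)` of the general Hogwild! recursion with step sizes `η`, filters `S`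
(parameter `D`), i.i.d. samples `ξ_t` of law `P`, uniformly selected filter indices `u_t`, and
position-wise inconsistent reads that are consistent with delay `τ(t)`.
The subtraction `t - τ t` is truncated, i.e. it is `max {t - τ(t), 0}`. -/
structure IsRun (Pr : Measure Ω) (P : Measure Ξ) (f : Vec d → Ξ → ℝ) (D : ℕ)
    (S : Ξ → ℕ → Set (Fin d)) (η : ℕ → ℝ) (τ : ℕ → ℕ)
    (ξ : ℕ → Ω → Ξ) (u : ℕ → Ω → ℕ) (Sig : ℕ → ℕ → Ω → Set (Fin d))
    (w what : ℕ → Ω → Vec d) : Prop where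
  /-- The initial vector has a finite second moment (it may be deterministic). -/
  measurable_init : Measurable (w 0)
  memLp_init : MemLp (w 0) 2 Pr
  measurable_sample : ∀ t, Measurable (ξ t)
  measurable_index : ∀ t, Measurable (u t)
  measurable_mask : ∀ t j, Measurable (Sig t j)
  /-- The sample `ξ_t` has law `P`. -/
  law_sample : ∀ t, Pr.map (ξ t) = P
  /-- Given `ξ_t = ξ`, the index `u_t` is uniform on `{u | u < d_ξ}` (nothing is required if
  `d_ξ = 0`, as the gradient vanishes identically then). -/
  law_index : ∀ t, ∀ B : Set Ξ, MeasurableSet B → ∀ k : ℕ,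
    Pr {ω | ξ t ω ∈ B ∧ k < numFilters f D (ξ t ω) ∧ u t ω = k} =
      ∫⁻ x in B ∩ {x | k < numFilters f D x}, ((numFilters f D x : ℕ) : ENNReal)⁻¹ ∂P
  /-- The draw of step `t` is independent of the past, including the read of `ŵ_t`. -/
  indep : ∀ t, Indep (history τ (w 0) ξ u Sig t)
    (MeasurableSpace.comap (fun ω => (ξ t ω, u t ω)) inferInstance) Pr
  /-- `ŵ_t` consists of `w_{t-τ(t)}` and of the position updates of the steps
  `t-τ(t), …, t-1` that are selected by the masks `Σ_{t,j}`. -/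
  read : ∀ t ω, what t ω = w (t - τ t) ω -
    ∑ j ∈ Finset.Ico (t - τ t) t, (η j * numFilters f D (ξ j ω)) •
      mask (Sig t j ω) (mask (S (ξ j ω) (u j ω)) (grad f (what j ω) (ξ j ω)))
  /-- `w_{t+1} = w_t - η_t d_{ξ_t} S^{ξ_t}_{u_t} ∇f(ŵ_t; ξ_t)`. -/
  update : ∀ t ω, w (t + 1) ω = w t ω - (η t * numFilters f D (ξ t ω)) •
    mask (S (ξ t ω) (u t ω)) (grad f (what t ω) (ξ t ω))

end Run

end Hogwild

end

/-!
Write `y_t = 𝔼‖w_t - w_*‖²`, `m_t = 𝔼‖ŵ_t - w_*‖²` and `δ_t = 𝔼‖w_t - ŵ_t‖²`. The theorem follows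
from two inequalities between these numbers, collected in `Hogwild.IsMomentRecursion`.

The step. Both `w_t` and `ŵ_t` are functions of the history, of which the draw `(ξ_t, u_t)` is
independent, so the draw can be averaged out for fixed `w_t = w` and `ŵ_t = v`. The filters
partition the support of the gradient, hence the stochastic gradient `d_ξ S^ξ_u ∇f(v; ξ)` has mean
`∇F(v)` and second moment at most `D 𝔼‖∇f(v; ξ)‖² ≤ D (2L²‖v - w_*‖² + N)`, by `L`-smoothness
(`lintegral_sq_norm_sub_stochGrad_le`). Strong convexity and the Lipschitz continuity of `∇F` give
`⟨w - w_*, ∇F(v)⟩ ≥ ¾μ‖v - w_*‖² - (L²/μ)‖w - v‖²`, so `y` contracts up to multiples of `η_t δ_t`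
and of `η_t²`.

The lag. The vectors `w_t` and `ŵ_t` differ by at most `τ(t)` updates, and masking an update does
not increase its norm. Cauchy-Schwarz bounds `δ_t` by `τ(t)` times the sum of the second moments of
these updates, however the masks depend on the draws. As `η_j ≤ 2α/(μt)` in the window and
`τ(t)² ≤ t / ln t`, this is `O(1/(t ln t))` as long as the moments are bounded (`lag_le_inv`).

For late times the recursion therefore reads `y_{t+1} ≤ (1 - 3/t) y_t + A/t² + O(1/(t² ln t))` with
`A = α²DN/μ²`. This yields `y_t ≤ A/t + O(1/(t ln t))` (`le_rate_of_contraction`), and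
`m_t ≤ 2y_t + 2δ_t` is then within the claimed `4A/t + O(1/(t ln t))`. The moments at early times
are bounded inductively by constants that depend on the parameters only (`exists_bound_initial`),
and the contraction keeps them bounded afterwards (`bounded_of_contraction`), so that the constant
`C` depends neither on the run nor on the step sizes.
-/

namespace Hogwild

/-! ### The recursion of the second moments -/

section MomentRecursion

/-- The inequalities between the second moments `y t = 𝔼‖w_t - w_*‖²`, `m t = 𝔼‖ŵ_t - w_*‖²` and
`δ t = 𝔼‖w_t - ŵ_t‖²` of a run, from which the rate is derived. -/
structure IsMomentRecursion (L μ N R : ℝ) (D : ℕ) (η : ℕ → ℝ) (τ : ℕ → ℕ)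
    (y m δ : ℕ → ℝ) : Prop where
  y_nonneg : ∀ t, 0 ≤ y t
  m_nonneg : ∀ t, 0 ≤ m t
  δ_nonneg : ∀ t, 0 ≤ δ t
  init : y 0 ≤ R
  step : ∀ t, y (t + 1) ≤ y t - 3 / 2 * η t * μ * m t + 2 * η t * L ^ 2 / μ * δ t +
    η t ^ 2 * (D * (2 * L ^ 2 * m t + N))
  m_le : ∀ t, m t ≤ 2 * y t + 2 * δ t
  y_le : ∀ t, y t ≤ 2 * m t + 2 * δ t
  lag : ∀ t, δ t ≤ τ t * ∑ j ∈ Finset.Ico (t - τ t) t, η j ^ 2 * (D * (2 * L ^ 2 * m j + N))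

variable {L μ N R : ℝ} {D : ℕ} {η : ℕ → ℝ} {τ : ℕ → ℕ} {y m δ : ℕ → ℝ}

/-- The lag is at most the square of the delay times the largest squared step size and the largest
second moment of the stochastic gradients in the window `[t - τ(t), t)`. -/
theorem IsMomentRecursion.lag_le (h : IsMomentRecursion L μ N R D η τ y m δ) (hN : 0 ≤ N)
    {t : ℕ} {H B k : ℝ} (hη : ∀ j ∈ Finset.Ico (t - τ t) t, 0 ≤ η j ∧ η j ≤ H)
    (hm : ∀ j < t, m j ≤ B) (hB : 0 ≤ B) (hk : ((Finset.Ico (t - τ t) t).card : ℝ) ≤ k) :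
    δ t ≤ τ t * (k * (H ^ 2 * (D * (2 * L ^ 2 * B + N)))) := by
  refine (h.lag t).trans ?_
  gcongr
  refine (Finset.sum_le_card_nsmul _ _ (H ^ 2 * (D * (2 * L ^ 2 * B + N))) ?_).trans ?_
  · intro j hj
    obtain ⟨h0, h1⟩ := hη j hj
    have := h.m_nonneg j
    have := hm j (Finset.mem_Ico.1 hj).2
    gcongr
  · rw [nsmul_eq_mul]
    gcongr

/-- Over any finite time range, the moments are bounded by a constant that does not depend on the
step sizes or on the run. -/
theorem exists_bound_initial (L μ N R : ℝ) (D : ℕ) (τ : ℕ → ℕ) (hμ : 0 < μ) (hN : 0 ≤ N)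
    (H : ℝ) (n : ℕ) :
    ∃ B : ℝ, 0 ≤ B ∧ ∀ (η y m δ : ℕ → ℝ), (∀ t, 0 ≤ η t ∧ η t ≤ H) →
      IsMomentRecursion L μ N R D η τ y m δ → ∀ t ≤ n, y t ≤ B ∧ m t ≤ B := by
  induction n with
  | zero =>
    refine ⟨2 * |R|, by positivity, fun η y m δ _ h t ht => ?_⟩
    obtain rfl : t = 0 := by omega
    have h1 := h.lag 0
    simp only [zero_tsub, Finset.Ico_self, Finset.sum_empty, mul_zero] at h1
    have h2 := h.m_le 0
    have h3 := h.init
    have h4 := le_abs_self R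
    have h5 := abs_nonneg R
    constructor <;> linarith
  | succ n ih =>
    obtain ⟨B, hB, hb⟩ := ih
    set Δ : ℕ → ℝ := fun t => τ t * (t * (H ^ 2 * (D * (2 * L ^ 2 * B + N)))) with hΔ
    have hΔ0 : ∀ t, 0 ≤ Δ t := fun t => by positivity
    set B₁ := B + 2 * |H| * L ^ 2 / μ * Δ n + H ^ 2 * (D * (2 * L ^ 2 * B + N)) with hB₁
    have hB₁0 : B ≤ B₁ := by
      have : 0 ≤ 2 * |H| * L ^ 2 / μ * Δ n := mul_nonneg (by positivity) (hΔ0 n)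
      have : 0 ≤ H ^ 2 * (D * (2 * L ^ 2 * B + N)) := by positivity
      linarith
    refine ⟨2 * B₁ + 2 * Δ (n + 1), by linarith [hΔ0 (n + 1)], fun η y m δ hη h t ht => ?_⟩
    have hb' := hb η y m δ hη h
    have hδ : ∀ t ≤ n + 1, δ t ≤ Δ t := fun t ht =>
      h.lag_le hN (fun j _ => hη j) (fun j hj => (hb' j (by omega)).2) hB
        (by rw [Nat.card_Ico]; exact_mod_cast (by omega))
    rcases Nat.lt_or_ge n t with hlt | hle
    · obtain rfl : t = n + 1 := by omega
      have hy : y (n + 1) ≤ B₁ := by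
        obtain ⟨h0, h1⟩ := hη n
        obtain ⟨h2, h3⟩ := hb' n le_rfl
        have h4 := h.m_nonneg n
        have h5 : 0 ≤ 3 / 2 * η n * μ * m n := by positivity
        have h6 : 2 * η n * L ^ 2 / μ * δ n ≤ 2 * |H| * L ^ 2 / μ * Δ n := by
          have := h.δ_nonneg n
          have := hδ n (by omega)
          have := h1.trans (le_abs_self H)
          gcongr
        have h7 : η n ^ 2 * (D * (2 * L ^ 2 * m n + N)) ≤ H ^ 2 * (D * (2 * L ^ 2 * B + N)) := by
          gcongr
        have := h.step n
        linarith
      have h8 := hδ (n + 1) le_rfl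
      have h9 := h.m_le (n + 1)
      have := hΔ0 (n + 1)
      constructor <;> linarith
    · have := hb' t hle
      have := hΔ0 (n + 1)
      constructor <;> linarith

/-- The comparison sequence `1 / (t ln t)` decreases slowly enough to be reproduced by the
contraction factor `1 - 2 / t`. -/
theorem one_sub_two_div_mul_le {t : ℝ} (ht : 2 ≤ t) (hlog : 1 ≤ Real.log t) :
    (1 - 2 / t) * (1 / (t * Real.log t)) ≤ 1 / ((t + 1) * Real.log (t + 1)) := by
  have h1 : Real.log (t + 1) ≤ Real.log t + 1 / t := by
    have h : Real.log (1 + 1 / t) ≤ 1 / t := by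
      have := Real.log_le_sub_one_of_pos (x := 1 + 1 / t) (by positivity)
      linarith
    have h' : t + 1 = t * (1 + 1 / t) := by field_simp
    rw [h', Real.log_mul (by positivity) (by positivity)]
    linarith
  have h2 : 0 < Real.log (t + 1) := Real.log_pos (by linarith)
  have h3 : (1 - 2 / t) * (1 / (t * Real.log t)) = (t - 2) / (t ^ 2 * Real.log t) := by
    field_simp
  rw [h3, div_le_div_iff₀ (by positivity) (by positivity)]
  have h4 : (t - 2) * ((t + 1) * Real.log (t + 1)) ≤
      (t - 2) * ((t + 1) * (Real.log t + 1 / t)) := by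
    have : 0 ≤ t - 2 := by linarith
    gcongr
  have h5 : (t - 2) * ((t + 1) * (Real.log t + 1 / t)) =
      (t ^ 2 - t - 2) * Real.log t + (t - 1 - 2 / t) := by
    field_simp
    ring
  have h6 : 0 < 2 / t := by positivity
  nlinarith

/-- A contraction `1 - 3 / t` against noise `A / t²` and a perturbation `K / (t² ln t)` yields the
rate `A / t + O(1 / (t ln t))`. -/
theorem le_rate_of_contraction {A K C : ℝ} (hA : 0 ≤ A) (hC : 0 ≤ C) (hKC : K ≤ C) {T : ℕ}
    (hT : 3 ≤ T) (hlog : ∀ t ≥ T, 1 ≤ Real.log (t : ℝ))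
    (hstart : y T ≤ C * (1 / (T * Real.log T)))
    (hstep : ∀ t ≥ T, y (t + 1) ≤
      (1 - 3 / (t : ℝ)) * y t + K * (1 / t ^ 2 * (1 / Real.log t)) + A * (1 / t ^ 2)) :
    ∀ t ≥ T, y t ≤ A * (1 / t) + C * (1 / (t * Real.log t)) := by
  intro t ht
  induction t, ht using Nat.le_induction with
  | base =>
    have : 0 ≤ A * (1 / (T : ℝ)) := by positivity
    linarith
  | succ t ht ih =>
    have htR : (3 : ℝ) ≤ t := by exact_mod_cast hT.trans ht
    have htR' : (0 : ℝ) < t := by linarith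
    have hl := hlog t ht
    have h0 : 0 ≤ 1 - 3 / (t : ℝ) := by
      rw [sub_nonneg, div_le_one (by linarith)]; exact htR
    have h1 := mul_le_mul_of_nonneg_left ih h0
    have h2 := mul_le_mul_of_nonneg_left (one_sub_two_div_mul_le (by linarith) hl) hC
    have h3 : K * (1 / (t : ℝ) ^ 2 * (1 / Real.log t)) ≤ C * (1 / t ^ 2 * (1 / Real.log t)) :=
      mul_le_mul_of_nonneg_right hKC (by positivity)
    have h4 : A * (1 / (t : ℝ) - 2 / t ^ 2) ≤ A * (1 / (t + 1)) := by
      refine mul_le_mul_of_nonneg_left ?_ hA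
      rw [div_sub_div _ _ (by positivity) (by positivity), div_le_div_iff₀ (by positivity)
        (by positivity)]
      nlinarith [pow_pos htR' 2]
    have h5 : (1 - 3 / (t : ℝ)) * (A * (1 / t) + C * (1 / (t * Real.log t))) +
        C * (1 / t ^ 2 * (1 / Real.log t)) + A * (1 / t ^ 2) =
        A * (1 / (t : ℝ) - 2 / t ^ 2) + C * ((1 - 2 / t) * (1 / (t * Real.log t))) := by
      field_simp
      ring
    push_cast
    linarith [hstep t ht]

/-- The upper bound on the delay gives `τ(t)² ≤ t / ln t` eventually. -/
theorem eventually_sq_delay_le (τ : ℕ → ℕ)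
    (hτ : ∀ᶠ t : ℕ in atTop,
      (τ t : ℝ) ≤ √((t : ℝ) * (1 / Real.log t - 1 / (Real.log t) ^ 2))) :
    ∀ᶠ t : ℕ in atTop, (τ t : ℝ) ^ 2 ≤ t / Real.log t := by
  filter_upwards [hτ, eventually_ge_atTop 1] with t ht h1
  have h1 : (1 : ℝ) ≤ t := by exact_mod_cast h1
  have hl : 0 ≤ Real.log (t : ℝ) := Real.log_nonneg h1
  have h2 : (τ t : ℝ) ^ 2 ≤ √((t : ℝ) * (1 / Real.log t - 1 / (Real.log t) ^ 2)) ^ 2 := by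
    gcongr
  rcases le_total 0 ((t : ℝ) * (1 / Real.log t - 1 / (Real.log t) ^ 2)) with h | h
  · rw [Real.sq_sqrt h] at h2
    refine h2.trans ?_
    rw [div_eq_mul_one_div (t : ℝ)]
    gcongr
    have : 0 ≤ 1 / Real.log (t : ℝ) ^ 2 := by positivity
    linarith
  · rw [Real.sqrt_eq_zero_of_nonpos h, zero_pow two_ne_zero] at h2
    exact h2.trans (by positivity)

/-- For late times the moment recursion contracts with factor `1 - 3 / t`. -/
theorem IsMomentRecursion.step_le (h : IsMomentRecursion L μ N R D η τ y m δ) (hμ : 0 < μ)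
    (hN : 0 ≤ N) {α : ℝ} {t : ℕ} (ht : 0 < t) (hη_lower : 6 / (t : ℝ) ≤ η t * μ)
    (hη_upper : η t ≤ α / (μ * t)) (hη_small : η t * (2 * D * L ^ 2) ≤ μ / 2) :
    y (t + 1) ≤ (1 - 3 / (t : ℝ)) * y t + α / μ * (μ + 2 * L ^ 2 / μ) * (1 / t) * δ t +
      α ^ 2 * D * N / μ ^ 2 * (1 / t ^ 2) := by
  have htR : (0 : ℝ) < t := by exact_mod_cast ht
  have hη : 0 < η t := by
    have : 0 < η t * μ := lt_of_lt_of_le (by positivity) hη_lower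
    exact pos_of_mul_pos_left this hμ.le
  have hm := h.m_nonneg t
  have hδ := h.δ_nonneg t
  have hy := h.y_nonneg t
  have h1 := h.step t
  have h2 : η t * (η t * (2 * D * L ^ 2)) * m t ≤ η t * (μ / 2) * m t := by gcongr
  have h3 : η t * μ * y t ≤ η t * μ * (2 * m t + 2 * δ t) := by
    have := h.y_le t
    gcongr
  have h4 : 6 / (t : ℝ) * y t ≤ η t * μ * y t := by gcongr
  have h5 : η t * (μ + 2 * L ^ 2 / μ) * δ t ≤ α / (μ * t) * (μ + 2 * L ^ 2 / μ) * δ t := by gcongr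
  have h6 : η t ^ 2 * (D * N) ≤ (α / (μ * t)) ^ 2 * (D * N) := by gcongr
  have h7 : α / μ * (μ + 2 * L ^ 2 / μ) * (1 / t) * δ t =
      α / (μ * t) * (μ + 2 * L ^ 2 / μ) * δ t := by field_simp
  have h8 : α ^ 2 * D * N / μ ^ 2 * (1 / (t : ℝ) ^ 2) = (α / (μ * t)) ^ 2 * (D * N) := by
    field_simp
  have h9 : (1 - 3 / (t : ℝ)) * y t = y t - 1 / 2 * (6 / (t : ℝ) * y t) := by ring
  have h10 : η t * (μ + 2 * L ^ 2 / μ) * δ t = η t * μ * δ t + 2 * η t * L ^ 2 / μ * δ t := by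
    ring
  rw [h7, h8, h9]
  linarith

theorem stepSize_nonneg_and_le {α μ a : ℝ} (hμ : 0 < μ) (ha : 12 ≤ a ∧ a ≤ α) (t k : ℕ) :
    0 ≤ a / (μ * ((t : ℝ) + 2 * (k : ℝ))) ∧ a / (μ * ((t : ℝ) + 2 * (k : ℝ))) ≤ α / μ := by
  obtain ⟨h1, h2⟩ := ha
  have h0 : 0 ≤ a := by linarith
  have hα : 0 ≤ α := h0.trans h2
  refine ⟨by positivity, ?_⟩
  -- a vanishing denominator gives the step size `0`, otherwise the denominator is at least `μ`
  rcases Nat.eq_zero_or_pos (t + 2 * k) with h | h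
  · have : (t : ℝ) + 2 * k = 0 := by exact_mod_cast h
    rw [this, mul_zero, div_zero]
    exact div_nonneg hα hμ.le
  · have : (1 : ℝ) ≤ t + 2 * k := by exact_mod_cast h
    have h3 : μ ≤ μ * ((t : ℝ) + 2 * k) := le_mul_of_one_le_right hμ.le this
    gcongr

theorem stepSize_le_of_pos {α μ a : ℝ} (hμ : 0 < μ) (ha : 12 ≤ a ∧ a ≤ α) {t : ℕ} (ht : 0 < t)
    (k : ℕ) : a / (μ * ((t : ℝ) + 2 * (k : ℝ))) ≤ α / (μ * t) := by
  have htR : (0 : ℝ) < t := by exact_mod_cast ht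
  obtain ⟨h1, h2⟩ := ha
  have h3 : 0 ≤ α := by linarith
  have h4 : (t : ℝ) ≤ t + 2 * k := by
    have : (0 : ℝ) ≤ k := k.cast_nonneg
    linarith
  gcongr

theorem six_div_le_stepSize_mul {α μ a : ℝ} (hμ : 0 < μ) (ha : 12 ≤ a ∧ a ≤ α) {t : ℕ}
    (ht : 0 < t) {k : ℕ} (hk : 2 * (k : ℝ) ≤ t) :
    6 / (t : ℝ) ≤ a / (μ * ((t : ℝ) + 2 * (k : ℝ))) * μ := by
  have htR : (0 : ℝ) < t := by exact_mod_cast ht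
  have hk0 : (0 : ℝ) ≤ k := k.cast_nonneg
  have h1 : a / (μ * ((t : ℝ) + 2 * (k : ℝ))) * μ = a / (t + 2 * k) := by
    field_simp
  rw [h1, div_le_div_iff₀ htR (by linarith)]
  nlinarith [ha.1]

/-- For late times the lag is of order `1 / (t ln t)`: there are at most `τ(t)` steps in the window,
their step sizes are at most `2α / (μ t)`, and `τ(t)² ≤ t / ln t`. -/
theorem IsMomentRecursion.lag_le_inv (h : IsMomentRecursion L μ N R D η τ y m δ) (hμ : 0 < μ)
    (hN : 0 ≤ N) {α M : ℝ} {t : ℕ} (ht : 0 < t) (hτ : (τ t : ℝ) ^ 2 ≤ t / Real.log t)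
    (hτ2 : 2 * (τ t : ℝ) ≤ t) (hα : 0 ≤ α)
    (hη : ∀ j, 0 ≤ η j) (hη_upper : ∀ j > 0, η j ≤ α / (μ * j)) (hM : 0 ≤ M)
    (hm : ∀ j < t, m j ≤ M) :
    δ t ≤ (8 * α ^ 2 * D * L ^ 2 / μ ^ 2 * M + 4 * α ^ 2 * D * N / μ ^ 2) *
      (1 / (t * Real.log t)) := by
  have htR : (0 : ℝ) < t := by exact_mod_cast ht
  have hτ2' : 2 * τ t ≤ t := by exact_mod_cast hτ2
  have h1 : δ t ≤ τ t * (τ t * ((2 * α / (μ * t)) ^ 2 * (D * (2 * L ^ 2 * M + N)))) := by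
    refine h.lag_le hN (fun j hj => ⟨hη j, ?_⟩) hm hM ?_
    · rw [Finset.mem_Ico] at hj
      have hj0 : 0 < j := by omega
      have hjR : (0 : ℝ) < j := by exact_mod_cast hj0
      refine (hη_upper j hj0).trans ?_
      have h2 : (t : ℝ) ≤ 2 * j := by exact_mod_cast (by omega : t ≤ 2 * j)
      rw [div_le_div_iff₀ (by positivity) (by positivity)]
      calc α * (μ * t) ≤ α * (μ * (2 * j)) := by gcongr
        _ = 2 * α * (μ * j) := by ring
    · rw [Nat.card_Ico]
      exact_mod_cast (by omega)
  have h2 : (τ t : ℝ) * (τ t * ((2 * α / (μ * t)) ^ 2 * (D * (2 * L ^ 2 * M + N)))) =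
      (τ t : ℝ) ^ 2 * ((2 * α / (μ * t)) ^ 2 * (D * (2 * L ^ 2 * M + N))) := by ring
  rw [h2] at h1
  refine h1.trans ((mul_le_mul_of_nonneg_right hτ (by positivity)).trans_eq ?_)
  rcases eq_or_ne (Real.log (t : ℝ)) 0 with h0 | h0
  · simp [h0]
  · field_simp
    ring

/-- If the lag at time `t` is at most `1 / t` times an affine function of the largest moment so far,
then the contraction `1 - 3 / t` keeps the moments bounded. -/
theorem bounded_of_contraction {b p q A B : ℝ} {T : ℕ} (hb : 0 ≤ b) (hA : 0 ≤ A)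
    (hB : 0 ≤ B) (hAB : A ≤ B) (hbqB : b * q ≤ B) (hqB : 4 * q ≤ B) (hT : 4 ≤ T)
    (hbpT : ∀ t ≥ T, b * (3 * p) ≤ (t : ℝ)) (hpT : ∀ t ≥ T, 12 * p ≤ (t : ℝ))
    (hstart : ∀ t ≤ T, y t ≤ B ∧ m t ≤ 3 * B)
    (hstep : ∀ t ≥ T, y (t + 1) ≤
      (1 - 3 / (t : ℝ)) * y t + b * (1 / t) * δ t + A * (1 / t ^ 2))
    (hm : ∀ t, m t ≤ 2 * y t + 2 * δ t)
    (hlag : ∀ t ≥ T, (∀ j < t, m j ≤ 3 * B) → δ t ≤ (p * (3 * B) + q) * (1 / t)) :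
    ∀ t, y t ≤ B ∧ m t ≤ 3 * B := by
  intro t
  induction t using Nat.strong_induction_on with
  | _ t ih =>
  rcases Nat.lt_or_ge T t with hTt | hTt
  · obtain ⟨s, rfl⟩ : ∃ s, t = s + 1 := ⟨t - 1, by omega⟩
    have hs : s ≥ T := by omega
    have hsR : (4 : ℝ) ≤ s := by exact_mod_cast hT.trans hs
    have hs0 : (0 : ℝ) < s := by linarith
    have h1 := hlag s hs fun j hj => (ih j (by omega)).2
    have h2 := hlag (s + 1) (by omega) fun j hj => (ih j (by omega)).2
    have h3 := (ih s (by omega)).1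
    have h4 := hbpT s hs
    have h5 := hpT s hs
    have hy : y (s + 1) ≤ B := by
      have h6 : b * (1 / (s : ℝ)) * δ s ≤ (1 / s) * (2 * B) := by
        calc b * (1 / (s : ℝ)) * δ s ≤ b * (1 / s) * ((p * (3 * B) + q) * (1 / s)) := by gcongr
          _ = 1 / s * ((b * (3 * p) * B + b * q) / s) := by ring
          _ ≤ 1 / s * (2 * B) := by
            refine mul_le_mul_of_nonneg_left ?_ (by positivity)
            rw [div_le_iff₀ hs0]
            have h7 : b * (3 * p) * B ≤ s * B := by gcongr
            have h8 : B * 1 ≤ B * s := by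
              refine mul_le_mul_of_nonneg_left ?_ hB
              linarith
            linarith
      have h7 : A * (1 / (s : ℝ) ^ 2) ≤ 1 / s * B := by
        have h8 : A * (1 / (s : ℝ) ^ 2) = 1 / s * (A / s) := by ring
        rw [h8]
        refine mul_le_mul_of_nonneg_left ?_ (by positivity)
        exact (div_le_self hA (by linarith)).trans hAB
      have h8 : (1 - 3 / (s : ℝ)) * y s ≤ (1 - 3 / s) * B := by
        refine mul_le_mul_of_nonneg_left h3 ?_
        rw [sub_nonneg, div_le_one hs0]
        linarith
      have h9 : (1 - 3 / (s : ℝ)) * B + 1 / s * (2 * B) + 1 / s * B = B := by ring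
      linarith [hstep s hs]
    refine ⟨hy, ?_⟩
    have h6 : (p * (3 * B) + q) * (1 / ((s + 1 : ℕ) : ℝ)) ≤ 1 / 2 * B := by
      push_cast
      rw [mul_one_div, div_le_iff₀ (by linarith)]
      have h7 : 12 * p * B ≤ s * B := by gcongr
      have h8 : 4 * B ≤ s * B := by gcongr
      linarith
    linarith [hm (s + 1)]
  · exact hstart t hTt

/-- The moment recursion implies `y (t + 1), m (t + 1) ≤ 4α²DN/μ² · 1/t + C/(t ln t)` with a
constant `C` that does not depend on the step sizes or on the moments. -/
theorem exists_rate_const (L μ N R : ℝ) (D : ℕ) (τ : ℕ → ℕ) (α : ℝ) (hμ : 0 < μ) (hN : 0 ≤ N)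
    (hτ : ∀ᶠ t : ℕ in atTop,
      (τ t : ℝ) ≤ √((t : ℝ) * (1 / Real.log t - 1 / (Real.log t) ^ 2))) :
    ∃ C : ℝ, ∀ αs : ℕ → ℝ, (∀ t, 12 ≤ αs t ∧ αs t ≤ α) → ∀ y m δ : ℕ → ℝ,
      IsMomentRecursion L μ N R D (fun t => αs t / (μ * ((t : ℝ) + 2 * (τ t : ℝ)))) τ y m δ →
      ∀ t : ℕ, 2 ≤ t →
        m (t + 1) ≤ 4 * α ^ 2 * D * N / μ ^ 2 * (1 / t) + C * (1 / (t * Real.log t)) ∧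
        y (t + 1) ≤ 4 * α ^ 2 * D * N / μ ^ 2 * (1 / t) + C * (1 / (t * Real.log t)) := by
  rcases lt_or_ge α 0 with hα | hα
  · exact ⟨0, fun αs hαs => absurd (hαs 0) (by intro h; linarith [h.1, h.2])⟩
  set p := 8 * α ^ 2 * D * L ^ 2 / μ ^ 2 with hp
  set q := 4 * α ^ 2 * D * N / μ ^ 2 with hq
  set b := α / μ * (μ + 2 * L ^ 2 / μ) with hb
  set A := α ^ 2 * D * N / μ ^ 2 with hA
  have hp0 : 0 ≤ p := by positivity
  have hq0 : 0 ≤ q := by positivity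
  have hb0 : 0 ≤ b := by positivity
  have hA0 : 0 ≤ A := by positivity
  have hqA : q = 4 * A := by rw [hq, hA]; ring
  have hcast := tendsto_natCast_atTop_atTop (R := ℝ)
  -- From `T` on: `τ² ≤ t / ln t`, the step size is small enough for `η² 2DL² m` to be absorbed by
  -- the contraction, and the feedback of the lag on the moments is dominated by it.
  obtain ⟨T, hT⟩ := eventually_atTop.1 (((((eventually_sq_delay_le τ hτ).and
    (hcast.eventually_ge_atTop (4 * α * D * L ^ 2 / μ ^ 2))).and
    (hcast.eventually_ge_atTop (b * (3 * p)))).and (hcast.eventually_ge_atTop (12 * p))).and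
    (((Real.tendsto_log_atTop.comp hcast).eventually_ge_atTop 1).and (eventually_ge_atTop 4)))
  obtain ⟨B₀, hB₀, hearly⟩ := exists_bound_initial L μ N R D τ hμ hN (α / μ) T
  -- `B` and `3 * B` bound all moments, `K / (t ln t)` bounds the lag, and `C` is the constant of
  -- the second-order term of `y`; `C` dominates both the perturbation `b * K` and the value at time `T`.
  set B := B₀ + b * q + A + 4 * q with hB
  have hbq0 : 0 ≤ b * q := by positivity
  have hB0 : 0 ≤ B := by positivity
  set K := p * (3 * B) + q with hK
  have hK0 : 0 ≤ K := by positivity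
  have hT4 : 4 ≤ T := (hT T le_rfl).2.2
  have hTR : (4 : ℝ) ≤ T := by exact_mod_cast hT4
  have hTlog : 1 ≤ Real.log (T : ℝ) := (hT T le_rfl).2.1
  have hTT : 0 < (T : ℝ) * Real.log T := by positivity
  set C := b * K + B * (T * Real.log T) with hC
  have hC0 : 0 ≤ C := by positivity
  refine ⟨2 * C + 2 * K + 3 * B * (T * Real.log T), fun αs hαs y m δ h => ?_⟩
  set η : ℕ → ℝ := fun t => αs t / (μ * ((t : ℝ) + 2 * (τ t : ℝ))) with hη
  have hη0 : ∀ t, 0 ≤ η t := fun t => (stepSize_nonneg_and_le hμ (hαs t) t (τ t)).1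
  have hη1 : ∀ t > 0, η t ≤ α / (μ * t) := fun t ht => stepSize_le_of_pos hμ (hαs t) ht (τ t)
  have hτ2 : ∀ t ≥ T, 2 * (τ t : ℝ) ≤ t := by
    intro t ht
    have h1 := (hT t ht).1.1.1.1
    have h2 : 1 ≤ Real.log (t : ℝ) := (hT t ht).2.1
    have h3 : (4 : ℝ) ≤ t := by exact_mod_cast (hT t ht).2.2
    have h4 : (t : ℝ) / Real.log t ≤ t := div_le_self (by linarith) h2
    refine (pow_le_pow_iff_left₀ (by positivity) (by linarith) two_ne_zero).1 ?_
    nlinarith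
  have hstep : ∀ t ≥ T, y (t + 1) ≤
      (1 - 3 / (t : ℝ)) * y t + b * (1 / t) * δ t + A * (1 / t ^ 2) := by
    intro t ht
    have ht0 : 0 < t := by omega
    have htR : (0 : ℝ) < t := by exact_mod_cast ht0
    refine h.step_le hμ hN ht0 (six_div_le_stepSize_mul hμ (hαs t) ht0 (hτ2 t ht)) (hη1 t ht0) ?_
    have h1 := (hT t ht).1.1.1.2
    calc η t * (2 * D * L ^ 2) ≤ α / (μ * t) * (2 * D * L ^ 2) := by
          have := hη1 t ht0
          gcongr
      _ = 4 * α * D * L ^ 2 / μ ^ 2 * (μ / 2 / t) := by field_simp; ring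
      _ ≤ t * (μ / 2 / t) := by gcongr
      _ = μ / 2 := by field_simp
  have hlag : ∀ t ≥ T, (∀ j < t, m j ≤ 3 * B) → δ t ≤ K * (1 / (t * Real.log t)) := by
    intro t ht hm
    exact h.lag_le_inv hμ hN (by omega) (hT t ht).1.1.1.1 (hτ2 t ht) hα hη0 hη1 (by positivity) hm
  have hlag' : ∀ t ≥ T, (∀ j < t, m j ≤ 3 * B) → δ t ≤ K * (1 / t) := by
    intro t ht hm
    refine (hlag t ht hm).trans ?_
    have h2 : 1 ≤ Real.log (t : ℝ) := (hT t ht).2.1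
    have htR : (0 : ℝ) < t := by exact_mod_cast (by omega : 0 < t)
    have h3 : (t : ℝ) ≤ t * Real.log t := le_mul_of_one_le_right htR.le h2
    gcongr
  clear_value p q b A B K C
  have hbound : ∀ t, y t ≤ B ∧ m t ≤ 3 * B :=
    bounded_of_contraction (p := p) (q := q) hb0 hA0 hB0 (by linarith) (by linarith)
      (by linarith) hT4
      (fun t ht => (hT t ht).1.1.2) (fun t ht => (hT t ht).1.2)
      (fun t ht => by
        have h1 := hearly η y m δ (fun t => stepSize_nonneg_and_le hμ (hαs t) t (τ t)) h t ht
        constructor <;> linarith [h1.1, h1.2])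
      hstep h.m_le (fun t ht h' => hK ▸ hlag' t ht h')
  have hrate := le_rate_of_contraction (y := y) (A := A) (K := b * K) (C := C) hA0 hC0
    (by rw [hC]; linarith [mul_nonneg hB0 hTT.le]) (by omega) (fun t ht => (hT t ht).2.1)
    (by
      rw [hC, mul_one_div, le_div_iff₀ hTT]
      have h1 : y T * (T * Real.log T) ≤ B * (T * Real.log T) := by
        have := (hbound T).1
        gcongr
      have h2 : 0 ≤ b * K := by positivity
      linarith)
    (by
      intro t ht
      have h1 := hlag t ht fun j _ => (hbound j).2
      have htR : (0 : ℝ) < t := by exact_mod_cast (by omega : 0 < t)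
      have h2 : b * (1 / (t : ℝ)) * δ t ≤ b * (1 / t) * (K * (1 / (t * Real.log t))) := by gcongr
      have h3 : b * (1 / (t : ℝ)) * (K * (1 / (t * Real.log t))) =
        b * K * (1 / t ^ 2 * (1 / Real.log t)) := by
        rw [one_div_mul_one_div, mul_mul_mul_comm, one_div_mul_one_div]
        ring_nf
      linarith [hstep t ht])
  intro t ht
  have ht2 : (2 : ℝ) ≤ t := by exact_mod_cast ht
  have hlt : 0 < Real.log (t : ℝ) := Real.log_pos (by linarith)
  have htt : 0 < 1 / ((t : ℝ) * Real.log t) := by positivity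
  have hq1 : 0 ≤ A * (1 / (t : ℝ)) := by positivity
  rw [hqA]
  rcases Nat.lt_or_ge t T with hlt' | hge
  · have h1 : (1 : ℝ) ≤ T * Real.log T * (1 / (t * Real.log t)) := by
      rw [mul_one_div, one_le_div (by positivity)]
      have : (t : ℝ) ≤ T := by exact_mod_cast hlt'.le
      gcongr
    have h2 : 3 * B * 1 ≤ 3 * B * (T * Real.log T * (1 / (t * Real.log t))) := by gcongr
    have h3 := hbound (t + 1)
    have h4 : 0 ≤ (2 * C + 2 * K) * (1 / ((t : ℝ) * Real.log t)) := by positivity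
    constructor <;> linarith [h3.1, h3.2]
  · have h1 := hrate (t + 1) (by omega)
    have h2 := hlag (t + 1) (by omega) fun j _ => (hbound j).2
    have h3 := h.m_le (t + 1)
    have h4 : 1 / ((t + 1 : ℕ) : ℝ) ≤ 1 / t := by
      gcongr
      simp
    have h5 : 1 / (((t + 1 : ℕ) : ℝ) * Real.log (t + 1 : ℕ)) ≤ 1 / (t * Real.log t) := by
      gcongr <;> simp
    have h6 : A * (1 / ((t + 1 : ℕ) : ℝ)) ≤ A * (1 / t) := by gcongr
    have h7 := mul_le_mul_of_nonneg_left h5 hC0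
    have h8 := mul_le_mul_of_nonneg_left h5 hK0
    have h9 : 0 ≤ 3 * B * (T * Real.log T) * (1 / ((t : ℝ) * Real.log t)) := by positivity
    have h10 : 0 ≤ C * (1 / ((t : ℝ) * Real.log t)) := by positivity
    have h11 : 0 ≤ K * (1 / ((t : ℝ) * Real.log t)) := by positivity
    constructor <;> linarith

end MomentRecursion

/-! ### The gradients of the loss and of the objective -/

section Gradients

variable {d : ℕ} {Ξ : Type*} {f : Vec d → Ξ → ℝ} {L : ℝ}

theorem IsSmoothLoss.hasGradientAt (h : IsSmoothLoss f L) (w : Vec d) (ξ : Ξ) :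
    HasGradientAt (fun v => f v ξ) (grad f w ξ) w :=
  ((h ξ).1 w).hasGradientAt

theorem IsSmoothLoss.continuous_grad (h : IsSmoothLoss f L) (ξ : Ξ) :
    Continuous fun w => grad f w ξ :=
  (LipschitzWith.of_dist_le' fun w w' => by
    rw [dist_eq_norm, dist_eq_norm]; exact (h ξ).2 w w').continuous

theorem IsSmoothLoss.norm_grad_le (h : IsSmoothLoss f L) (w w' : Vec d) (ξ : Ξ) :
    ‖grad f w ξ‖ ≤ ‖grad f w' ξ‖ + L * ‖w - w'‖ := by
  have h1 := norm_le_norm_add_norm_sub (grad f w' ξ) (grad f w ξ)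
  have h2 := (h ξ).2 w w'
  linarith [norm_sub_rev (grad f w' ξ) (grad f w ξ)]

theorem IsSmoothLoss.sq_norm_grad_le (h : IsSmoothLoss f L) (w w' : Vec d) (ξ : Ξ) :
    ‖grad f w ξ‖ ^ 2 ≤ 2 * L ^ 2 * ‖w - w'‖ ^ 2 + 2 * ‖grad f w' ξ‖ ^ 2 := by
  have h1 := h.norm_grad_le w w' ξ
  have h2 : ‖grad f w ξ‖ ^ 2 ≤ (‖grad f w' ξ‖ + L * ‖w - w'‖) ^ 2 := by gcongr
  nlinarith [sq_nonneg (‖grad f w' ξ‖ - L * ‖w - w'‖)]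

variable [MeasurableSpace Ξ]

/-- The coordinates of the gradient are limits of difference quotients. -/
theorem IsSmoothLoss.measurable_grad (h : IsSmoothLoss f L) (hf : ∀ w, Measurable (f w))
    (w : Vec d) : Measurable (grad f w) := by
  have hi : ∀ i, Measurable fun ξ => grad f w ξ i := by
    intro i
    refine measurable_of_tendsto_metrizable (f := fun (n : ℕ) ξ =>
      (n : ℝ) • (f (w + (n : ℝ)⁻¹ • EuclideanSpace.single i 1) ξ - f w ξ)) (fun n => ?_) ?_
    · exact ((hf _).sub (hf _)).const_mul (n : ℝ)
    · rw [tendsto_pi_nhds]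
      intro ξ
      have h1 := (h.hasGradientAt w ξ).hasFDerivAt.lim (EuclideanSpace.single i 1)
        (l := atTop) (c := fun n : ℕ => (n : ℝ))
        (tendsto_norm_atTop_atTop.comp tendsto_natCast_atTop_atTop)
      have h2 : (InnerProductSpace.toDual ℝ (Vec d)) (grad f w ξ) (EuclideanSpace.single i 1) =
          grad f w ξ i := by
        rw [InnerProductSpace.toDual_apply_apply, EuclideanSpace.inner_single_right]
        simp
      rwa [h2] at h1
  exact (WithLp.measurable_toLp 2 _).comp (measurable_pi_lambda _ hi)

theorem IsSmoothLoss.measurable_uncurry_grad (h : IsSmoothLoss f L)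
    (hf : ∀ w, Measurable (f w)) : Measurable (Function.uncurry (grad f)) :=
  measurable_uncurry_of_continuous_of_measurable h.continuous_grad (h.measurable_grad hf)

variable {P : Measure Ξ} {wstar : Vec d}

theorem noise_nonneg : 0 ≤ noise P f wstar := by
  have : 0 ≤ ∫ ξ, ‖grad f wstar ξ‖ ^ 2 ∂P := integral_nonneg fun ξ => by positivity
  unfold noise
  linarith

variable [IsProbabilityMeasure P]

theorem IsSmoothLoss.integrable_sq_norm_grad (h : IsSmoothLoss f L)
    (hf : ∀ w, Measurable (f w)) (hN : Integrable (fun ξ => ‖grad f wstar ξ‖ ^ 2) P)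
    (w : Vec d) : Integrable (fun ξ => ‖grad f w ξ‖ ^ 2) P := by
  refine Integrable.mono' (g := fun ξ => 2 * L ^ 2 * ‖w - wstar‖ ^ 2 + 2 * ‖grad f wstar ξ‖ ^ 2)
    ((integrable_const _).add (hN.const_mul 2))
    ((h.measurable_grad hf w).norm.pow_const 2).aestronglyMeasurable (ae_of_all _ fun ξ => ?_)
  rw [Real.norm_of_nonneg (by positivity)]
  exact h.sq_norm_grad_le w wstar ξ

theorem IsSmoothLoss.integrable_grad (h : IsSmoothLoss f L)
    (hf : ∀ w, Measurable (f w)) (hN : Integrable (fun ξ => ‖grad f wstar ξ‖ ^ 2) P)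
    (w : Vec d) : Integrable (grad f w) P :=
  ((memLp_two_iff_integrable_sq_norm (h.measurable_grad hf w).aestronglyMeasurable).2
    (h.integrable_sq_norm_grad hf hN w)).integrable one_le_two

theorem IsSmoothLoss.integral_sq_norm_grad_le (h : IsSmoothLoss f L)
    (hf : ∀ w, Measurable (f w)) (hN : Integrable (fun ξ => ‖grad f wstar ξ‖ ^ 2) P)
    (w : Vec d) :
    ∫ ξ, ‖grad f w ξ‖ ^ 2 ∂P ≤ 2 * L ^ 2 * ‖w - wstar‖ ^ 2 + noise P f wstar := by
  refine (integral_mono (h.integrable_sq_norm_grad hf hN w)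
    ((integrable_const _).add (hN.const_mul 2)) fun ξ => h.sq_norm_grad_le w wstar ξ).trans_eq ?_
  rw [integral_add' (integrable_const _) (hN.const_mul 2)]
  simp [noise, integral_const_mul]

/-- Differentiation under the integral sign: on the unit ball around `w` the gradients are dominated
by the integrable function `‖∇f(w; ·)‖ + L`. -/
theorem IsSmoothLoss.hasGradientAt_objective (h : IsSmoothLoss f L) (hL : 0 < L)
    (hf : ∀ w, Measurable (f w)) (hf_int : ∀ w, Integrable (f w) P)
    (hN : Integrable (fun ξ => ‖grad f wstar ξ‖ ^ 2) P) (w : Vec d) :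
    HasGradientAt (objective P f) (∫ ξ, grad f w ξ ∂P) w := by
  have hg := h.integrable_grad hf hN w
  have h1 := hasFDerivAt_integral_of_dominated_of_fderiv_le (𝕜 := ℝ) (μ := P) (F := f)
    (F' := fun v ξ => InnerProductSpace.toDual ℝ (Vec d) (grad f v ξ)) (x₀ := w)
    (s := Metric.ball w 1) (bound := fun ξ => ‖grad f w ξ‖ + L)
    (Metric.ball_mem_nhds w one_pos)
    (Eventually.of_forall fun v => (hf v).aestronglyMeasurable) (hf_int w)
    ((InnerProductSpace.toDual ℝ (Vec d)).continuous.comp_aestronglyMeasurable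
      hg.aestronglyMeasurable)
    (ae_of_all _ fun ξ v hv => by
      rw [LinearIsometryEquiv.norm_map]
      refine (h.norm_grad_le v w ξ).trans ?_
      rw [mem_ball_iff_norm] at hv
      nlinarith)
    (hg.norm.add (integrable_const L))
    (ae_of_all _ fun ξ v _ => (h.hasGradientAt v ξ).hasFDerivAt)
  have h2 : ∫ ξ, InnerProductSpace.toDual ℝ (Vec d) (grad f w ξ) ∂P =
      InnerProductSpace.toDual ℝ (Vec d) (∫ ξ, grad f w ξ ∂P) :=
    ((InnerProductSpace.toDual ℝ (Vec d)).toContinuousLinearEquiv.toContinuousLinearMap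
      |>.integral_comp_comm hg)
  rw [h2] at h1
  exact h1

theorem IsSmoothLoss.gradient_objective (h : IsSmoothLoss f L) (hL : 0 < L)
    (hf : ∀ w, Measurable (f w)) (hf_int : ∀ w, Integrable (f w) P)
    (hN : Integrable (fun ξ => ‖grad f wstar ξ‖ ^ 2) P) (w : Vec d) :
    gradient (objective P f) w = ∫ ξ, grad f w ξ ∂P :=
  (h.hasGradientAt_objective hL hf hf_int hN w).gradient

theorem IsSmoothLoss.norm_gradient_objective_sub_le (h : IsSmoothLoss f L) (hL : 0 < L)
    (hf : ∀ w, Measurable (f w)) (hf_int : ∀ w, Integrable (f w) P)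
    (hN : Integrable (fun ξ => ‖grad f wstar ξ‖ ^ 2) P) (w w' : Vec d) :
    ‖gradient (objective P f) w - gradient (objective P f) w'‖ ≤ L * ‖w - w'‖ := by
  rw [h.gradient_objective hL hf hf_int hN, h.gradient_objective hL hf hf_int hN,
    ← integral_sub (h.integrable_grad hf hN w) (h.integrable_grad hf hN w')]
  refine (norm_integral_le_of_norm_le_const (C := L * ‖w - w'‖)
    (ae_of_all _ fun ξ => (h ξ).2 w w')).trans_eq ?_
  simp

end Gradients

theorem gradient_eq_zero_of_forall_le {d : ℕ} {F : Vec d → ℝ} {x : Vec d}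
    (h : ∀ w, F x ≤ F w) : gradient F x = 0 := by
  have h1 : IsLocalMin F x := Eventually.of_forall h
  rw [gradient, h1.fderiv_eq_zero, map_zero]

/-- The descent inequality behind the recursion: the gradient at the stale point `v` still points
away from `w_*` as seen from `w`, up to the squared distance of `v` and `w`. -/
theorem IsStronglyConvex.inner_gradient_ge {d : ℕ} {F : Vec d → ℝ} {μ L : ℝ} {x : Vec d}
    (hF : IsStronglyConvex F μ) (hμ : 0 < μ) (hx : gradient F x = 0)
    (hL : ∀ v, ‖gradient F v - gradient F x‖ ≤ L * ‖v - x‖) (w v : Vec d) :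
    3 / 4 * μ * ‖v - x‖ ^ 2 - L ^ 2 / μ * ‖w - v‖ ^ 2 ≤ inner ℝ (w - x) (gradient F v) := by
  have h1 := hF v x
  have h2 := hF x v
  rw [hx, inner_zero_left] at h1
  rw [norm_sub_rev x v, ← neg_sub v x, inner_neg_right, real_inner_comm] at h2
  have h3 : inner ℝ (w - x) (gradient F v) =
      inner ℝ (v - x) (gradient F v) + inner ℝ (w - v) (gradient F v) := by
    rw [← inner_add_left]
    congr 1
    abel
  have h4 : -(‖w - v‖ * (L * ‖v - x‖)) ≤ inner ℝ (w - v) (gradient F v) := by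
    have h5 := hL v
    rw [hx, sub_zero] at h5
    have h6 := abs_le.1 (abs_real_inner_le_norm (w - v) (gradient F v))
    have h7 : ‖w - v‖ * ‖gradient F v‖ ≤ ‖w - v‖ * (L * ‖v - x‖) := by gcongr
    linarith [h6.1]
  have h5 : ‖w - v‖ * (L * ‖v - x‖) ≤ μ / 4 * ‖v - x‖ ^ 2 + L ^ 2 / μ * ‖w - v‖ ^ 2 := by
    have h6 : 0 ≤ (μ / 2 * ‖v - x‖ - L * ‖w - v‖) ^ 2 / μ := by positivity
    have h7 : (μ / 2 * ‖v - x‖ - L * ‖w - v‖) ^ 2 / μ =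
        μ / 4 * ‖v - x‖ ^ 2 + L ^ 2 / μ * ‖w - v‖ ^ 2 - ‖w - v‖ * (L * ‖v - x‖) := by
      field_simp
      ring
    linarith
  linarith

/-! ### Masks and filters -/

section Mask

variable {d : ℕ}

theorem mask_apply (A : Set (Fin d)) (v : Vec d) (i : Fin d) :
    mask A v i = A.indicator (fun i => v i) i := rfl

theorem mask_smul (A : Set (Fin d)) (c : ℝ) (v : Vec d) : mask A (c • v) = c • mask A v := by
  ext i
  by_cases h : i ∈ A <;> simp [mask_apply, h]

theorem norm_sub_mask_le (A : Set (Fin d)) (v : Vec d) : ‖v - mask A v‖ ≤ ‖v‖ := by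
  refine (sq_le_sq₀ (norm_nonneg _) (norm_nonneg _)).1 ?_
  rw [EuclideanSpace.norm_sq_eq, EuclideanSpace.norm_sq_eq]
  refine Finset.sum_le_sum fun i _ => ?_
  by_cases h : i ∈ A
  · simpa [mask_apply, h] using sq_nonneg (v i)
  · simp [mask_apply, h]

theorem norm_mask_le (A : Set (Fin d)) (v : Vec d) : ‖mask A v‖ ≤ ‖v‖ := by
  refine (sq_le_sq₀ (norm_nonneg _) (norm_nonneg _)).1 ?_
  rw [EuclideanSpace.norm_sq_eq, EuclideanSpace.norm_sq_eq]
  refine Finset.sum_le_sum fun i _ => ?_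
  by_cases h : i ∈ A
  · simp [mask_apply, h]
  · simpa [mask_apply, h] using sq_nonneg (v i)

theorem measurable_mask_uncurry : Measurable fun p : Set (Fin d) × Vec d => mask p.1 p.2 := by
  refine measurable_from_prod_countable_right fun A => ?_
  refine (WithLp.measurable_toLp 2 _).comp (measurable_pi_lambda _ fun i => ?_)
  by_cases h : i ∈ A
  · simpa [h] using (EuclideanSpace.proj (𝕜 := ℝ) i).continuous.measurable
  · simp [h]

theorem measurable_mask_comp {β : Type*} {mβ : MeasurableSpace β} {A : β → Set (Fin d)}
    {X : β → Vec d} (hA : Measurable A) (hX : Measurable X) :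
    Measurable fun b => mask (A b) (X b) :=
  measurable_mask_uncurry.comp (hA.prodMk hX)

theorem grad_apply_eq_zero {Ξ : Type*} {f : Vec d → Ξ → ℝ} {x : Ξ} {i : Fin d}
    (hi : i ∉ gradSupport f x) (v : Vec d) :
    grad f v x i = 0 := by
  by_contra h
  exact hi ⟨v, h⟩

theorem grad_eq_zero_of_numFilters_eq_zero {Ξ : Type*} {f : Vec d → Ξ → ℝ} {D : ℕ}
    (hD : 0 < D) {x : Ξ} (hx : numFilters f D x = 0)
    (v : Vec d) : grad f v x = 0 := by
  have h1 : (gradSupport f x).ncard = 0 := by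
    unfold numFilters at hx
    omega
  rw [Set.ncard_eq_zero (Set.toFinite _)] at h1
  ext i
  exact grad_apply_eq_zero (by rw [h1]; exact Set.notMem_empty i) v

variable {Ξ : Type*} [MeasurableSpace Ξ] {f : Vec d → Ξ → ℝ} {D : ℕ} {S : Ξ → ℕ → Set (Fin d)}

theorem IsFilterFamily.sum_indicator (h : IsFilterFamily f D S) (x : Ξ) {g : Fin d → ℝ}
    (hg : ∀ i ∉ gradSupport f x, g i = 0) (i : Fin d) :
    ∑ k ∈ Finset.range (numFilters f D x), (S x k).indicator g i = g i := by
  by_cases hi : i ∈ gradSupport f x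
  · have hi' := hi
    rw [← h.union x] at hi'
    simp only [Set.mem_iUnion, Set.mem_Iio] at hi'
    obtain ⟨k, hk, hik⟩ := hi'
    rw [Finset.sum_eq_single k]
    · simp [hik]
    · intro l hl hlk
      refine Set.indicator_of_notMem (fun hil => ?_) g
      exact Set.disjoint_left.1 (h.disjoint x (Finset.mem_range.1 hl) hk hlk) hil hik
    · intro hk'
      exact absurd (Finset.mem_range.2 hk) hk'
  · rw [hg i hi]
    refine Finset.sum_eq_zero fun k _ => ?_
    by_cases hik : i ∈ S x k
    · rw [Set.indicator_of_mem hik, hg i hi]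
    · rw [Set.indicator_of_notMem hik]

theorem IsFilterFamily.sum_mask (h : IsFilterFamily f D S) (x : Ξ) (v : Vec d) :
    ∑ k ∈ Finset.range (numFilters f D x), mask (S x k) (grad f v x) = grad f v x := by
  ext i
  rw [WithLp.ofLp_sum, Finset.sum_apply]
  exact h.sum_indicator x (fun i hi => grad_apply_eq_zero hi v) i

theorem IsFilterFamily.sum_sq_norm_mask (h : IsFilterFamily f D S) (x : Ξ) (v : Vec d) :
    ∑ k ∈ Finset.range (numFilters f D x), ‖mask (S x k) (grad f v x)‖ ^ 2 =
      ‖grad f v x‖ ^ 2 := by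
  simp_rw [EuclideanSpace.norm_sq_eq]
  rw [Finset.sum_comm]
  refine Finset.sum_congr rfl fun i _ => ?_
  rw [← h.sum_indicator x (g := fun i => ‖grad f v x i‖ ^ 2)
    (fun i hi => by simp [grad_apply_eq_zero hi v]) i]
  refine Finset.sum_congr rfl fun k _ => ?_
  by_cases hik : i ∈ S x k <;> simp [mask_apply, hik]

/-- By continuity of the gradient in `w`, a non-zero position is detected by a point of a countable
dense set. -/
theorem IsSmoothLoss.measurable_gradSupport {L : ℝ} (h : IsSmoothLoss f L)
    (hf : ∀ w, Measurable (f w)) : Measurable (gradSupport f) := by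
  rw [measurable_set_iff]
  intro i
  have h1 : ∀ x, i ∈ gradSupport f x ↔
      ∃ n, grad f (TopologicalSpace.denseSeq (Vec d) n) x i ≠ 0 := by
    intro x
    refine ⟨fun ⟨w, hw⟩ => ?_, fun ⟨n, hn⟩ => ⟨_, hn⟩⟩
    have h2 : Continuous fun w => grad f w x i :=
      (EuclideanSpace.proj (𝕜 := ℝ) i).continuous.comp (h.continuous_grad x)
    obtain ⟨n, hn⟩ := (TopologicalSpace.denseRange_denseSeq (Vec d)).exists_mem_open
      (isOpen_ne_fun h2 continuous_const) ⟨w, hw⟩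
    exact ⟨n, hn⟩
  simp_rw [h1]
  refine Measurable.exists fun n => ?_
  refine measurableSet_setOfPred.1 (measurableSet_eq_fun (?_) measurable_const).compl
  exact (EuclideanSpace.proj (𝕜 := ℝ) i).continuous.measurable.comp (h.measurable_grad hf _)

theorem IsSmoothLoss.measurable_numFilters {L : ℝ} (h : IsSmoothLoss f L)
    (hf : ∀ w, Measurable (f w)) (D : ℕ) : Measurable (numFilters f D) :=
  (Measurable.of_discrete (f := fun s : Set (Fin d) => min D s.ncard)).comp
    (h.measurable_gradSupport hf)

variable (f D S) in
/-- The stochastic gradient `d_ξ S^ξ_u ∇f(v; ξ)` at `v` for the sample and filter index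
`z = (ξ, u)`. -/
noncomputable def stochGrad (v : Vec d) (z : Ξ × ℕ) : Vec d :=
  (numFilters f D z.1 : ℝ) • mask (S z.1 z.2) (grad f v z.1)

theorem measurable_stochGrad {L : ℝ} (h : IsSmoothLoss f L) (hf : ∀ w, Measurable (f w))
    (hS : IsFilterFamily f D S) :
    Measurable fun p : Vec d × (Ξ × ℕ) => stochGrad f D S p.1 p.2 := by
  have h1 : Measurable fun z : Ξ × ℕ => S z.1 z.2 :=
    measurable_from_prod_countable_left fun k => hS.measurable k
  have h2 : Measurable fun x => (numFilters f D x : ℝ) :=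
    Measurable.of_discrete.comp (h.measurable_numFilters hf D)
  have h3 : Measurable fun p : Vec d × (Ξ × ℕ) => grad f p.1 p.2.1 :=
    (h.measurable_uncurry_grad hf).comp (measurable_fst.prodMk measurable_snd.fst)
  exact (h2.comp measurable_snd.fst).smul (measurable_mask_comp (h1.comp measurable_snd) h3)

theorem measurable_stochGrad_comp {L : ℝ} (h : IsSmoothLoss f L) (hf : ∀ w, Measurable (f w))
    (hS : IsFilterFamily f D S) {β : Type*} {mβ : MeasurableSpace β} {X : β → Vec d}
    {Z : β → Ξ × ℕ} (hX : Measurable X) (hZ : Measurable Z) :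
    Measurable fun b => stochGrad f D S (X b) (Z b) := by
  have h1 := (measurable_stochGrad h hf hS).comp (hX.prodMk hZ)
  exact h1

/-- Averaging over the filters: the masked gradients sum to the gradient, and so do their squared
norms. -/
theorem IsFilterFamily.sum_sq_norm_sub_stochGrad (h : IsFilterFamily f D S) (x : Ξ)
    (v a : Vec d) (η : ℝ) :
    ∑ k ∈ Finset.range (numFilters f D x), ‖a - η • stochGrad f D S v (x, k)‖ ^ 2 =
      numFilters f D x * (‖a‖ ^ 2 - 2 * η * inner ℝ a (grad f v x) +
        η ^ 2 * (numFilters f D x * ‖grad f v x‖ ^ 2)) := by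
  have h1 : ∀ k, ‖a - η • stochGrad f D S v (x, k)‖ ^ 2 = ‖a‖ ^ 2 -
      2 * η * numFilters f D x * inner ℝ a (mask (S x k) (grad f v x)) +
      η ^ 2 * (numFilters f D x) ^ 2 * ‖mask (S x k) (grad f v x)‖ ^ 2 := by
    intro k
    rw [norm_sub_sq_real, stochGrad, smul_smul, inner_smul_right, norm_smul, mul_pow,
      Real.norm_eq_abs, sq_abs]
    ring
  simp_rw [h1]
  rw [Finset.sum_add_distrib, Finset.sum_sub_distrib, ← Finset.mul_sum, ← Finset.mul_sum,
    ← inner_sum, h.sum_mask, h.sum_sq_norm_mask, Finset.sum_const, Finset.card_range,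
    nsmul_eq_mul]
  ring

end Mask

/-! ### The law of a sample and its filter index -/

/-- If `x` has law `P` and, given `x`, the index `k` is uniform on `{k | k < n x}`, then the
expectation of `ψ(x, k)` is that of its average over `k`. When `n x = 0` the law of the index is
not specified, and `ψ(x, k)` must not depend on `k`. -/
theorem lintegral_uniform_index {Ξ : Type*} [MeasurableSpace Ξ] {P : Measure Ξ}
    [IsProbabilityMeasure P] {ν : Measure (Ξ × ℕ)} {n : Ξ → ℕ} {D : ℕ} (hn : Measurable n)
    (hnD : ∀ x, n x ≤ D) (hfst : ν.map Prod.fst = P)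
    (hidx : ∀ B, MeasurableSet B → ∀ k : ℕ, ν {z | z.1 ∈ B ∧ k < n z.1 ∧ z.2 = k} =
      ∫⁻ x in B ∩ {x | k < n x}, (n x : ENNReal)⁻¹ ∂P)
    {ψ : Ξ × ℕ → ENNReal} (hψ : Measurable ψ) {r : Ξ → ENNReal} (hr : Measurable r)
    (h0 : ∀ x k, n x = 0 → ψ (x, k) = r x)
    (h1 : ∀ x, 0 < n x → ∑ k ∈ Finset.range (n x), ψ (x, k) = n x * r x) :
    ∫⁻ z, ψ z ∂ν = ∫⁻ x, r x ∂P := by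
  have hν : IsProbabilityMeasure ν := by
    constructor
    rw [← Set.preimage_univ (f := Prod.fst), ← Measure.map_apply measurable_fst .univ, hfst,
      measure_univ]
  set A : ℕ → Set (Ξ × ℕ) := fun k => {z | k < n z.1 ∧ z.2 = k} with hA
  have hAm : ∀ k, MeasurableSet (A k) := fun k =>
    (measurableSet_lt measurable_const (hn.comp measurable_fst)).inter
      (measurableSet_eq_fun measurable_snd measurable_const)
  have hnm : ∀ k, MeasurableSet {x | k < n x} := fun k => measurableSet_lt measurable_const hn
  have hZ : MeasurableSet {x | n x = 0} := measurableSet_eq_fun hn measurable_const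
  have hinv : Measurable fun x => (n x : ENNReal)⁻¹ := (Measurable.of_discrete.comp hn).inv
  -- on the slice `A k` the first coordinate has density `1 / n` on `{k < n}`
  have hslice : ∀ k, (ν.restrict (A k)).map Prod.fst =
      (P.restrict {x | k < n x}).withDensity fun x => (n x : ENNReal)⁻¹ := by
    intro k
    ext B hB
    rw [Measure.map_apply measurable_fst hB, Measure.restrict_apply (measurable_fst hB),
      withDensity_apply _ hB, Measure.restrict_restrict hB]
    exact hidx B hB k
  have key : ∀ (φ : Ξ × ℕ → ENNReal) (s : Ξ → ENNReal), Measurable φ → Measurable s →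
      (∀ x, 0 < n x → ∑ k ∈ Finset.range (n x), φ (x, k) = n x * s x) →
      ∫⁻ z, ((Prod.fst ⁻¹' {x | n x = 0}).indicator (fun z => s z.1) z +
        ∑ k ∈ Finset.range D, (A k).indicator (fun z => φ (z.1, k)) z) ∂ν = ∫⁻ x, s x ∂P := by
    intro φ s hφ hs hsum
    have hφk : ∀ k, Measurable fun x => φ (x, k) := fun k => hφ.comp measurable_prodMk_right
    have hm : Measurable ((Prod.fst ⁻¹' {x | n x = 0}).indicator fun z : Ξ × ℕ => s z.1) :=
      (hs.comp measurable_fst).indicator (measurable_fst hZ)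
    have hmk : ∀ k, Measurable ((A k).indicator fun z : Ξ × ℕ => φ (z.1, k)) := fun k =>
      ((hφk k).comp measurable_fst).indicator (hAm k)
    rw [lintegral_add_left hm,
      lintegral_finsetSum _ fun k _ => hmk k]
    have e1 : ∫⁻ z, (Prod.fst ⁻¹' {x | n x = 0}).indicator (fun z => s z.1) z ∂ν =
        ∫⁻ x, {x | n x = 0}.indicator s x ∂P := by
      rw [← hfst, lintegral_map (hs.indicator hZ) measurable_fst]
      rfl
    have e2 : ∀ k, ∫⁻ z, (A k).indicator (fun z => φ (z.1, k)) z ∂ν =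
        ∫⁻ x, {x | k < n x}.indicator (fun x => (n x : ENNReal)⁻¹ * φ (x, k)) x ∂P := by
      intro k
      rw [lintegral_indicator (hAm k), ← lintegral_map (hφk k) measurable_fst, hslice k,
        lintegral_withDensity_eq_lintegral_mul _ hinv (hφk k), lintegral_indicator (hnm k)]
      rfl
    have hmk' : ∀ k, Measurable
        ({x | k < n x}.indicator fun x => (n x : ENNReal)⁻¹ * φ (x, k)) := fun k =>
      (hinv.mul (hφk k)).indicator (hnm k)
    rw [e1, Finset.sum_congr rfl fun k _ => e2 k, ← lintegral_finsetSum _ fun k _ => hmk' k,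
      ← lintegral_add_left (hs.indicator hZ)]
    refine lintegral_congr fun x => ?_
    rcases Nat.eq_zero_or_pos (n x) with hx | hx
    · simp [hx]
    · have e3 : ∑ k ∈ Finset.range D,
          {x | k < n x}.indicator (fun x => (n x : ENNReal)⁻¹ * φ (x, k)) x =
          ∑ k ∈ Finset.range (n x), (n x : ENNReal)⁻¹ * φ (x, k) := by
        rw [← Finset.sum_subset (Finset.range_mono (hnD x))]
        · refine Finset.sum_congr rfl fun k hk => ?_
          exact Set.indicator_of_mem (show x ∈ {x | k < n x} from Finset.mem_range.1 hk) _
        · intro k _ hk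
          exact Set.indicator_of_notMem
            (show x ∉ {x | k < n x} from fun h => hk (Finset.mem_range.2 h)) _
      rw [e3, ← Finset.mul_sum, hsum x hx, ← mul_assoc,
        ENNReal.inv_mul_cancel (by exact_mod_cast hx.ne') (ENNReal.natCast_ne_top _), one_mul,
        Set.indicator_of_notMem (by simpa using hx.ne'), zero_add]
  have hval : ∀ (φ : Ξ × ℕ → ENNReal) (s : Ξ → ENNReal) (z : Ξ × ℕ), n z.1 = 0 ∨ z.2 < n z.1 →
      (n z.1 = 0 → φ z = s z.1) →
      (Prod.fst ⁻¹' {x | n x = 0}).indicator (fun z => s z.1) z +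
        ∑ k ∈ Finset.range D, (A k).indicator (fun z => φ (z.1, k)) z = φ z := by
    rintro φ s ⟨x, l⟩ hz hs
    rcases hz with hz | hz
    · simp only at hz hs
      simp [hA, hz, hs hz]
    · simp only at hz
      have hz0 : n x ≠ 0 := by omega
      rw [Finset.sum_eq_single l]
      · simp [hA, hz, hz0]
      · intro k _ hk
        simp [hA, hk.symm]
      · intro hl
        exact absurd (Finset.mem_range.2 (hz.trans_le (hnD x))) hl
  -- the admissible indices carry the full mass
  have hG : ∀ᵐ z ∂ν, n z.1 = 0 ∨ z.2 < n z.1 := by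
    have hm : MeasurableSet {z : Ξ × ℕ | n z.1 = 0 ∨ z.2 < n z.1} :=
      (measurable_fst hZ).union (measurableSet_lt measurable_snd (hn.comp measurable_fst))
    refine (prob_compl_eq_zero_iff hm).2 ?_
    have h2 := key (fun _ => 1) (fun _ => 1) measurable_const measurable_const (by simp)
    rw [lintegral_const, measure_univ, one_mul] at h2
    rw [← h2, ← lintegral_indicator_one hm]
    refine lintegral_congr fun z => ?_
    by_cases hz : z ∈ {z : Ξ × ℕ | n z.1 = 0 ∨ z.2 < n z.1}
    · rw [hval (fun _ => 1) (fun _ => 1) z hz (fun _ => rfl)]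
      exact Set.indicator_of_mem hz _
    · rw [Set.indicator_of_notMem hz]
      rw [Set.mem_ofPred_eq, not_or] at hz
      rw [Set.indicator_of_notMem (by simpa using hz.1), zero_add]
      refine (Finset.sum_eq_zero fun k _ => Set.indicator_of_notMem ?_ _).symm
      rintro ⟨h3, h4⟩
      omega
  rw [← key ψ r hψ hr h1]
  refine lintegral_congr_ae ?_
  filter_upwards [hG] with z hz
  exact (hval ψ r z hz fun h => h0 z.1 z.2 h).symm

/-! ### One step of the recursion -/

section Step

variable {d : ℕ} {Ξ : Type*} [MeasurableSpace Ξ] {P : Measure Ξ} [IsProbabilityMeasure P]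
  {f : Vec d → Ξ → ℝ} {L : ℝ} {D : ℕ} {S : Ξ → ℕ → Set (Fin d)} {wstar : Vec d}
  {ν : Measure (Ξ × ℕ)}

/-- The mean squared norm of `a - η d_ξ S^ξ_u ∇f(v; ξ)` for fixed `a` and `v`: the stochastic
gradient has mean `∇F(v)`, and its second moment is at most `D (2L²‖v - w_*‖² + N)`. -/
theorem lintegral_sq_norm_sub_stochGrad_le (h : IsSmoothLoss f L) (hL : 0 < L)
    (hf : ∀ w, Measurable (f w)) (hf_int : ∀ w, Integrable (f w) P)
    (hN : Integrable (fun ξ => ‖grad f wstar ξ‖ ^ 2) P) (hD : 0 < D)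
    (hS : IsFilterFamily f D S) (hfst : ν.map Prod.fst = P)
    (hidx : ∀ B, MeasurableSet B → ∀ k : ℕ,
      ν {z | z.1 ∈ B ∧ k < numFilters f D z.1 ∧ z.2 = k} =
        ∫⁻ x in B ∩ {x | k < numFilters f D x}, (numFilters f D x : ENNReal)⁻¹ ∂P)
    (a v : Vec d) (η : ℝ) :
    0 ≤ ‖a‖ ^ 2 - 2 * η * inner ℝ a (gradient (objective P f) v) +
        η ^ 2 * (D * (2 * L ^ 2 * ‖v - wstar‖ ^ 2 + noise P f wstar)) ∧
      ∫⁻ z, ENNReal.ofReal (‖a - η • stochGrad f D S v z‖ ^ 2) ∂ν ≤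
        ENNReal.ofReal (‖a‖ ^ 2 - 2 * η * inner ℝ a (gradient (objective P f) v) +
          η ^ 2 * (D * (2 * L ^ 2 * ‖v - wstar‖ ^ 2 + noise P f wstar))) := by
  have hg := h.measurable_grad hf v
  have hn : Measurable fun x => (numFilters f D x : ℝ) :=
    Measurable.of_discrete.comp (h.measurable_numFilters hf D)
  have hG : Measurable (stochGrad f D S v) :=
    measurable_stochGrad_comp h hf hS measurable_const measurable_id
  have hgi := h.integrable_grad hf hN v
  have hg2 := h.integrable_sq_norm_grad hf hN v
  set r : Ξ → ℝ := fun x => ‖a‖ ^ 2 - 2 * η * inner ℝ a (grad f v x) +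
    η ^ 2 * (numFilters f D x * ‖grad f v x‖ ^ 2) with hr
  set r' : Ξ → ℝ := fun x => ‖a‖ ^ 2 - 2 * η * inner ℝ a (grad f v x) +
    η ^ 2 * (D * ‖grad f v x‖ ^ 2) with hr'
  have hrm : Measurable r := by
    refine (measurable_const.sub ((measurable_const.inner hg).const_mul _)).add
      ((hn.mul (hg.norm.pow_const 2)).const_mul _)
  have h1 : ∫⁻ z, ENNReal.ofReal (‖a - η • stochGrad f D S v z‖ ^ 2) ∂ν =
      ∫⁻ x, ENNReal.ofReal (r x) ∂P := by
    have hψ : Measurable fun z => ENNReal.ofReal (‖a - η • stochGrad f D S v z‖ ^ 2) :=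
      ((measurable_const.sub (hG.const_smul η)).norm.pow_const 2).ennreal_ofReal
    refine lintegral_uniform_index (h.measurable_numFilters hf D) (fun x => min_le_left _ _)
      hfst hidx hψ hrm.ennreal_ofReal (fun x k hx => ?_) fun x hx => ?_
    · simp [hr, stochGrad, hx, grad_eq_zero_of_numFilters_eq_zero hD hx]
    · rw [← ENNReal.ofReal_sum_of_nonneg fun k _ => by positivity,
        hS.sum_sq_norm_sub_stochGrad x v a η, ENNReal.ofReal_mul (by positivity),
        ENNReal.ofReal_natCast]
  have hrr : ∀ x, r x ≤ r' x := by
    intro x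
    have : (numFilters f D x : ℝ) ≤ D := by exact_mod_cast min_le_left _ _
    simp only [hr, hr']
    gcongr
  have hr0 : ∀ x, 0 ≤ r' x := by
    intro x
    have h2 : ‖a - η • grad f v x‖ ^ 2 ≤ r' x := by
      rw [norm_sub_sq_real, inner_smul_right, norm_smul, mul_pow, Real.norm_eq_abs, sq_abs]
      have h3 : (1 : ℝ) ≤ D := by exact_mod_cast hD
      have h4 : ‖grad f v x‖ ^ 2 ≤ D * ‖grad f v x‖ ^ 2 :=
        le_mul_of_one_le_left (by positivity) h3
      have h5 : η ^ 2 * ‖grad f v x‖ ^ 2 ≤ η ^ 2 * (D * ‖grad f v x‖ ^ 2) := by gcongr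
      simp only [hr']
      linarith
    exact (sq_nonneg _).trans h2
  have hi1 : Integrable (fun x => 2 * η * inner ℝ a (grad f v x)) P :=
    (hgi.const_inner a).const_mul _
  have hi2 : Integrable (fun x => η ^ 2 * (D * ‖grad f v x‖ ^ 2)) P :=
    (hg2.const_mul _).const_mul _
  have hi3 : Integrable (fun x => ‖a‖ ^ 2 - 2 * η * inner ℝ a (grad f v x)) P :=
    (integrable_const _).sub hi1
  have hri : Integrable r' P := hi3.add hi2
  have hint : ∫ x, r' x ∂P ≤ ‖a‖ ^ 2 - 2 * η * inner ℝ a (gradient (objective P f) v) +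
      η ^ 2 * (D * (2 * L ^ 2 * ‖v - wstar‖ ^ 2 + noise P f wstar)) := by
    have h2 : ∫ x, r' x ∂P = ‖a‖ ^ 2 - 2 * η * inner ℝ a (gradient (objective P f) v) +
        η ^ 2 * (D * ∫ x, ‖grad f v x‖ ^ 2 ∂P) := by
      simp only [hr']
      rw [integral_add hi3 hi2, integral_sub (integrable_const _) hi1,
        integral_const_mul, integral_const_mul, integral_const_mul, integral_inner hgi,
        h.gradient_objective hL hf hf_int hN]
      simp
    rw [h2]
    have := h.integral_sq_norm_grad_le hf hN v
    gcongr
  refine ⟨(integral_nonneg hr0).trans hint, ?_⟩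
  rw [h1]
  calc ∫⁻ x, ENNReal.ofReal (r x) ∂P ≤ ∫⁻ x, ENNReal.ofReal (r' x) ∂P :=
        lintegral_mono fun x => ENNReal.ofReal_le_ofReal (hrr x)
    _ = ENNReal.ofReal (∫ x, r' x ∂P) :=
        (ofReal_integral_eq_lintegral_ofReal hri (ae_of_all _ hr0)).symm
    _ ≤ _ := ENNReal.ofReal_le_ofReal hint

end Step

/-! ### Measurability and moments of a run -/

section History

variable {d : ℕ} {Ω Ξ : Type*} [MeasurableSpace Ξ] {τ : ℕ → ℕ} {ξ : ℕ → Ω → Ξ} {u : ℕ → Ω → ℕ}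
  {Sig : ℕ → ℕ → Ω → Set (Fin d)}

theorem history_mono (w₀ : Ω → Vec d) : Monotone (history τ w₀ ξ u Sig) := by
  intro s t hst
  refine sup_le_sup (sup_le_sup le_rfl ?_) ?_
  · exact biSup_mono fun j hj => Finset.range_mono hst hj
  · exact biSup_mono fun j hj => Finset.range_mono (Nat.succ_le_succ hst) hj

theorem measurable_history_init (w₀ : Ω → Vec d) (t : ℕ) :
    Measurable[history τ w₀ ξ u Sig t] w₀ :=
  measurable_iff_comap_le.2 (le_sup_left.trans le_sup_left)

theorem measurable_history_draw (w₀ : Ω → Vec d) {j t : ℕ} (h : j < t) :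
    Measurable[history τ w₀ ξ u Sig t] fun ω => (ξ j ω, u j ω) :=
  measurable_iff_comap_le.2 (le_trans (le_biSup (fun j => MeasurableSpace.comap
    (fun ω => (ξ j ω, u j ω)) inferInstance) (Finset.mem_range.2 h))
    (le_sup_right.trans le_sup_left))

theorem measurable_history_mask (w₀ : Ω → Vec d) {j t : ℕ} (h : j ∈ Finset.Ico (t - τ t) t) :
    Measurable[history τ w₀ ξ u Sig t] (Sig t j) :=
  measurable_iff_comap_le.2 (le_trans (le_biSup (fun j => MeasurableSpace.comap
    (Sig t j) inferInstance) h) (le_trans (le_biSup (fun s => ⨆ j ∈ Finset.Ico (s - τ s) s,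
      MeasurableSpace.comap (Sig s j) inferInstance) (Finset.self_mem_range_succ t))
    le_sup_right))

end History

section Run

variable {d : ℕ} {Ω Ξ : Type*} [mΩ : MeasurableSpace Ω] [MeasurableSpace Ξ] {Pr : Measure Ω}
  {P : Measure Ξ} {f : Vec d → Ξ → ℝ} {L : ℝ} {D : ℕ} {S : Ξ → ℕ → Set (Fin d)}
  {η : ℕ → ℝ} {τ : ℕ → ℕ} {ξ : ℕ → Ω → Ξ} {u : ℕ → Ω → ℕ} {Sig : ℕ → ℕ → Ω → Set (Fin d)}
  {w what : ℕ → Ω → Vec d}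

/-- The recursion in terms of the stochastic gradients
`G_t = d_{ξ_t} S^{ξ_t}_{u_t} ∇f(ŵ_t; ξ_t)`. -/
theorem IsRun.update_eq (h : IsRun Pr P f D S η τ ξ u Sig w what) (t : ℕ) (ω : Ω) :
    w (t + 1) ω = w t ω - η t • stochGrad f D S (what t ω) (ξ t ω, u t ω) := by
  rw [h.update, stochGrad, smul_smul]

theorem IsRun.read_eq (h : IsRun Pr P f D S η τ ξ u Sig w what) (t : ℕ) (ω : Ω) :
    what t ω = w (t - τ t) ω - ∑ j ∈ Finset.Ico (t - τ t) t,
      η j • mask (Sig t j ω) (stochGrad f D S (what j ω) (ξ j ω, u j ω)) := by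
  rw [h.read]
  congr 1
  refine Finset.sum_congr rfl fun j _ => ?_
  rw [stochGrad, mask_smul, smul_smul]

theorem IsRun.history_le (h : IsRun Pr P f D S η τ ξ u Sig w what) (t : ℕ) :
    history τ (w 0) ξ u Sig t ≤ mΩ := by
  refine sup_le (sup_le h.measurable_init.comap_le ?_) ?_
  · exact iSup₂_le fun j _ => ((h.measurable_sample j).prodMk (h.measurable_index j)).comap_le
  · exact iSup₂_le fun s _ => iSup₂_le fun j _ => (h.measurable_mask s j).comap_le

/-- Both `w_t` and `ŵ_t` are functions of the history that precedes the draw of step `t`. -/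
theorem IsRun.measurable_history (h : IsRun Pr P f D S η τ ξ u Sig w what)
    (hsm : IsSmoothLoss f L) (hf : ∀ w, Measurable (f w)) (hS : IsFilterFamily f D S) (t : ℕ) :
    Measurable[history τ (w 0) ξ u Sig t] (w t) ∧
      Measurable[history τ (w 0) ξ u Sig t] (what t) := by
  induction t using Nat.strong_induction_on with
  | _ t ih =>
  have hGj : ∀ j < t, Measurable[history τ (w 0) ξ u Sig t]
      fun ω => stochGrad f D S (what j ω) (ξ j ω, u j ω) := by
    intro j hj
    exact measurable_stochGrad_comp hsm hf hS ((ih j hj).2.mono (history_mono _ hj.le) le_rfl)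
      (measurable_history_draw _ hj)
  have hw : Measurable[history τ (w 0) ξ u Sig t] (w t) := by
    cases t with
    | zero => exact measurable_history_init _ _
    | succ t =>
      rw [funext (h.update_eq t)]
      exact ((ih t t.lt_succ_self).1.mono (history_mono _ t.le_succ) le_rfl).sub
        ((hGj t t.lt_succ_self).const_smul (η t))
  refine ⟨hw, ?_⟩
  rw [funext (h.read_eq t)]
  refine Measurable.sub ?_ (Finset.measurable_sum _ fun j hj => ?_)
  · rcases (Nat.sub_le t (τ t)).eq_or_lt with hs | hs
    · rw [hs]
      exact hw
    · exact (ih _ hs).1.mono (history_mono _ hs.le) le_rfl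
  · exact (measurable_mask_comp (measurable_history_mask _ hj)
      (hGj j (Finset.mem_Ico.1 hj).2)).const_smul (η j)

theorem IsRun.measurable (h : IsRun Pr P f D S η τ ξ u Sig w what)
    (hsm : IsSmoothLoss f L) (hf : ∀ w, Measurable (f w)) (hS : IsFilterFamily f D S) (t : ℕ) :
    Measurable (w t) ∧ Measurable (what t) ∧
      Measurable fun ω => stochGrad f D S (what t ω) (ξ t ω, u t ω) := by
  have h1 := h.measurable_history hsm hf hS t
  have h2 := h1.2.mono (h.history_le t) le_rfl
  exact ⟨h1.1.mono (h.history_le t) le_rfl, h2, measurable_stochGrad_comp hsm hf hS h2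
    ((h.measurable_sample t).prodMk (h.measurable_index t))⟩

/-- Since the draw of step `t` is independent of `(w_t, ŵ_t)`, it can be averaged out first. -/
theorem IsRun.lintegral_eq (h : IsRun Pr P f D S η τ ξ u Sig w what) [IsProbabilityMeasure Pr]
    (hsm : IsSmoothLoss f L) (hf : ∀ w, Measurable (f w)) (hS : IsFilterFamily f D S) (t : ℕ)
    {Φ : (Vec d × Vec d) × (Ξ × ℕ) → ENNReal} (hΦ : Measurable Φ) :
    ∫⁻ ω, Φ ((w t ω, what t ω), (ξ t ω, u t ω)) ∂Pr =
      ∫⁻ ω, ∫⁻ z, Φ ((w t ω, what t ω), z) ∂(Pr.map fun ω => (ξ t ω, u t ω)) ∂Pr := by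
  have h1 := h.measurable_history hsm hf hS t
  have hY : Measurable[history τ (w 0) ξ u Sig t] fun ω => (w t ω, what t ω) := h1.1.prodMk h1.2
  have hY' := hY.mono (h.history_le t) le_rfl
  have hZ : Measurable fun ω => (ξ t ω, u t ω) :=
    (h.measurable_sample t).prodMk (h.measurable_index t)
  have hind : IndepFun (fun ω => (w t ω, what t ω)) (fun ω => (ξ t ω, u t ω)) Pr :=
    (IndepFun_iff_Indep _ _ _).2 (indep_of_indep_of_le_left (h.indep t) hY.comap_le)
  have hp : IsProbabilityMeasure (Pr.map fun ω => (ξ t ω, u t ω)) :=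
    Measure.isProbabilityMeasure_map hZ.aemeasurable
  rw [← lintegral_map hΦ (hY'.prodMk hZ),
    (indepFun_iff_map_prod_eq_prod_map_map hY'.aemeasurable hZ.aemeasurable).1 hind,
    lintegral_prod _ hΦ.aemeasurable, lintegral_map hΦ.lintegral_prod_right' hY']

theorem IsRun.map_fst_draw (h : IsRun Pr P f D S η τ ξ u Sig w what) (t : ℕ) :
    (Pr.map fun ω => (ξ t ω, u t ω)).map Prod.fst = P := by
  rw [Measure.map_map measurable_fst ((h.measurable_sample t).prodMk (h.measurable_index t))]
  exact h.law_sample t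

theorem IsRun.draw_slice (h : IsRun Pr P f D S η τ ξ u Sig w what)
    (hsm : IsSmoothLoss f L) (hf : ∀ w, Measurable (f w)) (t : ℕ) (B : Set Ξ)
    (hB : MeasurableSet B) (k : ℕ) :
    (Pr.map fun ω => (ξ t ω, u t ω)) {z | z.1 ∈ B ∧ k < numFilters f D z.1 ∧ z.2 = k} =
      ∫⁻ x in B ∩ {x | k < numFilters f D x}, (numFilters f D x : ENNReal)⁻¹ ∂P := by
  have hm : MeasurableSet {z : Ξ × ℕ | z.1 ∈ B ∧ k < numFilters f D z.1 ∧ z.2 = k} :=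
    (measurable_fst hB).inter ((measurableSet_lt measurable_const
      ((hsm.measurable_numFilters hf D).comp measurable_fst)).inter
      (measurableSet_eq_fun measurable_snd measurable_const))
  rw [Measure.map_apply ((h.measurable_sample t).prodMk (h.measurable_index t)) hm]
  exact h.law_index t B hB k

theorem IsRun.eq_sub_sum (h : IsRun Pr P f D S η τ ξ u Sig w what) {s t : ℕ} (hst : s ≤ t) (ω : Ω) :
    w t ω = w s ω - ∑ j ∈ Finset.Ico s t,
      η j • stochGrad f D S (what j ω) (ξ j ω, u j ω) := by
  induction t, hst using Nat.le_induction with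
  | base => simp
  | succ t hst ih =>
    rw [Finset.sum_Ico_succ_top hst, h.update_eq, ih]
    abel

/-- The distance of `w_t` and `ŵ_t` only involves the updates of the last `τ(t)` steps. The
read masks enter through `‖G - ΣG‖ ≤ ‖G‖` only, so they may depend on the draws. -/
theorem IsRun.sq_norm_sub_le (h : IsRun Pr P f D S η τ ξ u Sig w what) (t : ℕ) (ω : Ω) :
    ‖w t ω - what t ω‖ ^ 2 ≤ τ t * ∑ j ∈ Finset.Ico (t - τ t) t,
      η j ^ 2 * ‖stochGrad f D S (what j ω) (ξ j ω, u j ω)‖ ^ 2 := by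
  set G : ℕ → Vec d := fun j => stochGrad f D S (what j ω) (ξ j ω, u j ω) with hG
  have h1 : ‖w t ω - what t ω‖ ≤ ∑ j ∈ Finset.Ico (t - τ t) t, |η j| * ‖G j‖ := by
    have h2 : what t ω - w t ω =
        ∑ j ∈ Finset.Ico (t - τ t) t, η j • (G j - mask (Sig t j ω) (G j)) := by
      simp_rw [smul_sub]
      rw [Finset.sum_sub_distrib, h.read_eq t ω, h.eq_sub_sum (Nat.sub_le t (τ t)) ω]
      abel
    rw [norm_sub_rev, h2]
    refine (norm_sum_le _ _).trans (Finset.sum_le_sum fun j _ => ?_)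
    rw [norm_smul, Real.norm_eq_abs]
    have := norm_sub_mask_le (Sig t j ω) (G j)
    gcongr
  have h3 : ((Finset.Ico (t - τ t) t).card : ℝ) ≤ τ t := by
    rw [Nat.card_Ico]
    exact_mod_cast (by omega)
  calc ‖w t ω - what t ω‖ ^ 2 ≤ (∑ j ∈ Finset.Ico (t - τ t) t, |η j| * ‖G j‖) ^ 2 := by gcongr
    _ ≤ (Finset.Ico (t - τ t) t).card * ∑ j ∈ Finset.Ico (t - τ t) t, (|η j| * ‖G j‖) ^ 2 :=
      sq_sum_le_card_mul_sum_sq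
    _ ≤ τ t * ∑ j ∈ Finset.Ico (t - τ t) t, (|η j| * ‖G j‖) ^ 2 := by gcongr
    _ = _ := by simp_rw [mul_pow, sq_abs, hG]

variable [IsProbabilityMeasure Pr] [IsProbabilityMeasure P] {wstar : Vec d}

/-- The one-step bound along a run: the mean squared norm of `a(w_t) - c G_t`, where `G_t` is the
stochastic gradient of step `t`. -/
theorem IsRun.lintegral_sq_norm_le (h : IsRun Pr P f D S η τ ξ u Sig w what)
    (hsm : IsSmoothLoss f L) (hL : 0 < L) (hf : ∀ w, Measurable (f w))
    (hf_int : ∀ w, Integrable (f w) P)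
    (hN : Integrable (fun ξ => ‖grad f wstar ξ‖ ^ 2) P) (hD : 0 < D)
    (hS : IsFilterFamily f D S) (t : ℕ) (c : ℝ) {a : Vec d → Vec d} (ha : Measurable a) :
    ∫⁻ ω, ENNReal.ofReal
        (‖a (w t ω) - c • stochGrad f D S (what t ω) (ξ t ω, u t ω)‖ ^ 2) ∂Pr ≤
      ∫⁻ ω, ENNReal.ofReal (‖a (w t ω)‖ ^ 2 -
        2 * c * inner ℝ (a (w t ω)) (gradient (objective P f) (what t ω)) +
        c ^ 2 * (D * (2 * L ^ 2 * ‖what t ω - wstar‖ ^ 2 + noise P f wstar))) ∂Pr := by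
  have hΦ : Measurable fun p : (Vec d × Vec d) × (Ξ × ℕ) =>
      ENNReal.ofReal (‖a p.1.1 - c • stochGrad f D S p.1.2 p.2‖ ^ 2) :=
    (((ha.comp measurable_fst.fst).sub ((measurable_stochGrad_comp hsm hf hS
      measurable_fst.snd measurable_snd).const_smul c)).norm.pow_const 2).ennreal_ofReal
  rw [h.lintegral_eq hsm hf hS t hΦ]
  exact lintegral_mono fun ω => (lintegral_sq_norm_sub_stochGrad_le hsm hL hf hf_int hN hD hS
    (h.map_fst_draw t) (h.draw_slice hsm hf t) (a (w t ω)) (what t ω) c).2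

theorem _root_.MeasureTheory.MemLp.integrable_sq_norm_sub_const {X : Ω → Vec d}
    (hX : MemLp X 2 Pr) (c : Vec d) : Integrable (fun ω => ‖X ω - c‖ ^ 2) Pr :=
  (hX.sub (memLp_const c)).integrable_norm_pow two_ne_zero

/-- Square integrability of `ŵ_t` passes to the stochastic gradient of step `t`, with the explicit
bound on its second moment. -/
theorem IsRun.memLp_stochGrad (h : IsRun Pr P f D S η τ ξ u Sig w what)
    (hsm : IsSmoothLoss f L) (hL : 0 < L) (hf : ∀ w, Measurable (f w))
    (hf_int : ∀ w, Integrable (f w) P)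
    (hN : Integrable (fun ξ => ‖grad f wstar ξ‖ ^ 2) P) (hD : 0 < D)
    (hS : IsFilterFamily f D S) {t : ℕ} (ht : MemLp (what t) 2 Pr) :
    MemLp (fun ω => stochGrad f D S (what t ω) (ξ t ω, u t ω)) 2 Pr ∧
      ∫ ω, ‖stochGrad f D S (what t ω) (ξ t ω, u t ω)‖ ^ 2 ∂Pr ≤
        D * (2 * L ^ 2 * ∫ ω, ‖what t ω - wstar‖ ^ 2 ∂Pr + noise P f wstar) := by
  have hNn : 0 ≤ noise P f wstar := noise_nonneg
  have hm := (h.measurable hsm hf hS t).2.2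
  -- the case `a = 0`, `c = 1` of the one-step bound
  have h1 := h.lintegral_sq_norm_le hsm hL hf hf_int hN hD hS t 1
    (measurable_const (a := (0 : Vec d)))
  simp only [zero_sub, norm_neg, one_smul, norm_zero, inner_zero_left, mul_zero, one_pow, one_mul,
    ne_eq, OfNat.ofNat_ne_zero, not_false_eq_true, zero_pow, zero_add, sub_zero] at h1
  have h2 := ht.integrable_sq_norm_sub_const wstar
  have h3 : Integrable (fun ω => 2 * L ^ 2 * ‖what t ω - wstar‖ ^ 2) Pr := h2.const_mul _
  have h4 : Integrable (fun ω =>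
      D * (2 * L ^ 2 * ‖what t ω - wstar‖ ^ 2 + noise P f wstar)) Pr :=
    (h3.add (integrable_const _)).const_mul _
  have h5 : ∫ ω, D * (2 * L ^ 2 * ‖what t ω - wstar‖ ^ 2 + noise P f wstar) ∂Pr =
      D * (2 * L ^ 2 * ∫ ω, ‖what t ω - wstar‖ ^ 2 ∂Pr + noise P f wstar) := by
    rw [integral_const_mul, integral_add h3 (integrable_const _), integral_const_mul]
    simp
  have h6 : ∀ ω, 0 ≤ D * (2 * L ^ 2 * ‖what t ω - wstar‖ ^ 2 + noise P f wstar) :=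
    fun ω => by positivity
  rw [← ofReal_integral_eq_lintegral_ofReal h4 (ae_of_all _ h6), h5] at h1
  have h7 : Integrable (fun ω => ‖stochGrad f D S (what t ω) (ξ t ω, u t ω)‖ ^ 2) Pr :=
    (lintegral_ofReal_ne_top_iff_integrable (hm.norm.pow_const 2).aestronglyMeasurable
      (ae_of_all _ fun ω => by positivity)).1 (ne_top_of_le_ne_top ENNReal.ofReal_ne_top h1)
  refine ⟨(memLp_two_iff_integrable_sq_norm hm.aestronglyMeasurable).2 h7, ?_⟩
  rw [← ofReal_integral_eq_lintegral_ofReal h7 (ae_of_all _ fun ω => by positivity)] at h1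
  exact (ENNReal.ofReal_le_ofReal_iff (h5 ▸ integral_nonneg h6)).1 h1

/-- The explicit form of `w_t` and `ŵ_t` only involves stochastic gradients of earlier steps, so
square integrability propagates by strong induction. -/
theorem IsRun.memLp (h : IsRun Pr P f D S η τ ξ u Sig w what)
    (hsm : IsSmoothLoss f L) (hL : 0 < L) (hf : ∀ w, Measurable (f w))
    (hf_int : ∀ w, Integrable (f w) P)
    (hN : Integrable (fun ξ => ‖grad f wstar ξ‖ ^ 2) P) (hD : 0 < D)
    (hS : IsFilterFamily f D S) (t : ℕ) : MemLp (w t) 2 Pr ∧ MemLp (what t) 2 Pr := by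
  induction t using Nat.strong_induction_on with
  | _ t ih =>
  have hG : ∀ j < t, MemLp (fun ω => stochGrad f D S (what j ω) (ξ j ω, u j ω)) 2 Pr :=
    fun j hj => (h.memLp_stochGrad hsm hL hf hf_int hN hD hS (ih j hj).2).1
  have hw : MemLp (w t) 2 Pr := by
    cases t with
    | zero => exact h.memLp_init
    | succ t =>
      rw [funext (h.update_eq t)]
      exact (ih t t.lt_succ_self).1.sub ((hG t t.lt_succ_self).const_smul (η t))
  refine ⟨hw, ?_⟩
  rw [funext (h.read_eq t)]
  refine MemLp.sub ?_ (memLp_finsetSum _ fun j hj => ?_)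
  · rcases (Nat.sub_le t (τ t)).eq_or_lt with hs | hs
    · rw [hs]
      exact hw
    · exact (ih _ hs).1
  · refine MemLp.const_smul ((hG j (Finset.mem_Ico.1 hj).2).mono ?_
      (ae_of_all _ fun ω => norm_mask_le _ _)) (η j)
    exact (measurable_mask_comp (h.measurable_mask t j)
      (h.measurable hsm hf hS j).2.2).aestronglyMeasurable

theorem sq_norm_le_two_mul_add (a b c : Vec d) :
    ‖a - c‖ ^ 2 ≤ 2 * ‖b - c‖ ^ 2 + 2 * ‖b - a‖ ^ 2 := by
  have h1 : ‖a - c‖ ≤ ‖b - c‖ + ‖b - a‖ := by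
    have := norm_sub_le_norm_sub_add_norm_sub a b c
    rw [norm_sub_rev a b] at this
    linarith
  have h2 : ‖a - c‖ ^ 2 ≤ (‖b - c‖ + ‖b - a‖) ^ 2 := by gcongr
  nlinarith [sq_nonneg (‖b - c‖ - ‖b - a‖)]

theorem IsRun.isMomentRecursion (h : IsRun Pr P f D S η τ ξ u Sig w what)
    (hsm : IsSmoothLoss f L) (hL : 0 < L) (hf : ∀ w, Measurable (f w))
    (hf_int : ∀ w, Integrable (f w) P)
    (hN : Integrable (fun ξ => ‖grad f wstar ξ‖ ^ 2) P) (hD : 0 < D)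
    (hS : IsFilterFamily f D S) {μ R : ℝ} (hμ : 0 < μ)
    (hF : IsStronglyConvex (objective P f) μ)
    (hwstar : ∀ w, objective P f wstar ≤ objective P f w) (hη : ∀ t, 0 ≤ η t)
    (hR : ∫ ω, ‖w 0 ω - wstar‖ ^ 2 ∂Pr ≤ R) :
    IsMomentRecursion L μ (noise P f wstar) R D η τ (fun t => ∫ ω, ‖w t ω - wstar‖ ^ 2 ∂Pr)
      (fun t => ∫ ω, ‖what t ω - wstar‖ ^ 2 ∂Pr) (fun t => ∫ ω, ‖w t ω - what t ω‖ ^ 2 ∂Pr) := by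
  have hLp := h.memLp hsm hL hf hf_int hN hD hS
  have hy : ∀ t, Integrable (fun ω => ‖w t ω - wstar‖ ^ 2) Pr := fun t =>
    (hLp t).1.integrable_sq_norm_sub_const wstar
  have hm : ∀ t, Integrable (fun ω => ‖what t ω - wstar‖ ^ 2) Pr := fun t =>
    (hLp t).2.integrable_sq_norm_sub_const wstar
  have hδ : ∀ t, Integrable (fun ω => ‖w t ω - what t ω‖ ^ 2) Pr := fun t =>
    ((hLp t).1.sub (hLp t).2).integrable_norm_pow two_ne_zero
  refine ⟨fun t => integral_nonneg fun ω => by positivity,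
    fun t => integral_nonneg fun ω => by positivity,
    fun t => integral_nonneg fun ω => by positivity, hR, fun t => ?_, fun t => ?_, fun t => ?_,
    fun t => ?_⟩
  · set N := noise P f wstar
    set H : Ω → ℝ := fun ω => ‖w t ω - wstar‖ ^ 2 - 3 / 2 * η t * μ * ‖what t ω - wstar‖ ^ 2 +
      2 * η t * L ^ 2 / μ * ‖w t ω - what t ω‖ ^ 2 +
      η t ^ 2 * (D * (2 * L ^ 2 * ‖what t ω - wstar‖ ^ 2 + N)) with hH
    have hle : ∀ ω, ‖w t ω - wstar‖ ^ 2 -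
        2 * η t * inner ℝ (w t ω - wstar) (gradient (objective P f) (what t ω)) +
        η t ^ 2 * (D * (2 * L ^ 2 * ‖what t ω - wstar‖ ^ 2 + N)) ≤ H ω := by
      intro ω
      have h1 := hF.inner_gradient_ge hμ (gradient_eq_zero_of_forall_le hwstar)
        (fun v => hsm.norm_gradient_objective_sub_le hL hf hf_int hN v wstar) (w t ω) (what t ω)
      have h2 := mul_le_mul_of_nonneg_left h1 (hη t)
      simp only [hH]
      have h3 : 2 * η t * L ^ 2 / μ * ‖w t ω - what t ω‖ ^ 2 =
        2 * (η t * (L ^ 2 / μ * ‖w t ω - what t ω‖ ^ 2)) := by ring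
      rw [h3]
      linarith
    have hH0 : ∀ ω, 0 ≤ H ω := fun ω =>
      (lintegral_sq_norm_sub_stochGrad_le hsm hL hf hf_int hN hD hS (h.map_fst_draw t)
        (h.draw_slice hsm hf t) (w t ω - wstar) (what t ω) (η t)).1.trans (hle ω)
    have h1 := h.lintegral_sq_norm_le hsm hL hf hf_int hN hD hS t (η t)
      (measurable_id.sub_const wstar)
    have i1 := (hm t).const_mul (3 / 2 * η t * μ)
    have i2 := (hδ t).const_mul (2 * η t * L ^ 2 / μ)
    have i3 := (hm t).const_mul (2 * L ^ 2)
    have i4 : Integrable (fun ω => η t ^ 2 * (D * (2 * L ^ 2 * ‖what t ω - wstar‖ ^ 2 + N))) Pr :=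
      ((i3.add (integrable_const N)).const_mul (D : ℝ)).const_mul (η t ^ 2)
    have i5 : Integrable (fun ω => ‖w t ω - wstar‖ ^ 2 -
        3 / 2 * η t * μ * ‖what t ω - wstar‖ ^ 2) Pr := (hy t).sub i1
    have i6 : Integrable (fun ω => ‖w t ω - wstar‖ ^ 2 -
        3 / 2 * η t * μ * ‖what t ω - wstar‖ ^ 2 +
        2 * η t * L ^ 2 / μ * ‖w t ω - what t ω‖ ^ 2) Pr := i5.add i2
    have hHi : Integrable H Pr := i6.add i4
    have hHint : ∫ ω, H ω ∂Pr = ∫ ω, ‖w t ω - wstar‖ ^ 2 ∂Pr -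
        3 / 2 * η t * μ * ∫ ω, ‖what t ω - wstar‖ ^ 2 ∂Pr +
        2 * η t * L ^ 2 / μ * ∫ ω, ‖w t ω - what t ω‖ ^ 2 ∂Pr +
        η t ^ 2 * (D * (2 * L ^ 2 * ∫ ω, ‖what t ω - wstar‖ ^ 2 ∂Pr + N)) := by
      simp only [hH]
      rw [integral_add i6 i4, integral_add i5 i2,
        integral_sub (hy t) i1, integral_const_mul, integral_const_mul, integral_const_mul,
        integral_const_mul, integral_add i3 (integrable_const N), integral_const_mul]
      simp
    rw [← hHint, ← ENNReal.ofReal_le_ofReal_iff (integral_nonneg hH0),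
      ofReal_integral_eq_lintegral_ofReal (hy (t + 1)) (ae_of_all _ fun ω => by positivity),
      ofReal_integral_eq_lintegral_ofReal hHi (ae_of_all _ hH0)]
    refine le_trans (le_of_eq (lintegral_congr fun ω => ?_)) (h1.trans
      (lintegral_mono fun ω => ENNReal.ofReal_le_ofReal (hle ω)))
    rw [h.update_eq, sub_right_comm]
    rfl
  · rw [← integral_const_mul, ← integral_const_mul,
      ← integral_add ((hy t).const_mul 2) ((hδ t).const_mul 2)]
    exact integral_mono (hm t) (((hy t).const_mul 2).add ((hδ t).const_mul 2))
      fun ω => sq_norm_le_two_mul_add _ _ _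
  · rw [← integral_const_mul, ← integral_const_mul,
      ← integral_add ((hm t).const_mul 2) ((hδ t).const_mul 2)]
    refine integral_mono (hy t) (((hm t).const_mul 2).add ((hδ t).const_mul 2)) fun ω => ?_
    have h1 := sq_norm_le_two_mul_add (w t ω) (what t ω) wstar
    rwa [norm_sub_rev (what t ω) (w t ω)] at h1
  · have hG := fun j => h.memLp_stochGrad hsm hL hf hf_int hN hD hS (hLp j).2
    have hGi : ∀ j, Integrable (fun ω => η j ^ 2 *
        ‖stochGrad f D S (what j ω) (ξ j ω, u j ω)‖ ^ 2) Pr := fun j =>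
      ((hG j).1.integrable_norm_pow two_ne_zero).const_mul _
    refine (integral_mono (hδ t) ((integrable_finsetSum _ fun j _ => hGi j).const_mul _)
      (h.sq_norm_sub_le t)).trans ?_
    rw [integral_const_mul, integral_finsetSum _ fun j _ => hGi j]
    gcongr with j hj
    rw [integral_const_mul]
    exact mul_le_mul_of_nonneg_left (hG j).2 (sq_nonneg _)

end Run

end Hogwild

theorem mainTheorem9 {d : ℕ} {Ξ : Type*} [MeasurableSpace Ξ]
    (P : Measure Ξ) [IsProbabilityMeasure P]
    (f : Hogwild.Vec d → Ξ → ℝ) (L μ : ℝ) (hL : 0 < L) (hμ : 0 < μ)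
    (hf_meas : ∀ w, Measurable (f w)) (hf_int : ∀ w, Integrable (f w) P)
    (hF : Hogwild.IsStronglyConvex (Hogwild.objective P f) μ)
    (hf_smooth : Hogwild.IsSmoothLoss f L)
    (hf_convex : Hogwild.IsConvexLoss f)
    (wstar : Hogwild.Vec d)
    (hwstar : ∀ w, Hogwild.objective P f wstar ≤ Hogwild.objective P f w)
    (hN : Integrable (fun ξ => ‖Hogwild.grad f wstar ξ‖ ^ 2) P)
    (D : ℕ) (hD : 0 < D) (α : ℝ)
    (τ : ℕ → ℕ) (hτ_mono : Monotone τ)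
    (hτ_lower : ∀ t, 2 * L * α * D / μ ≤ (τ t : ℝ))
    (hτ_upper : ∀ᶠ t : ℕ in atTop,
      (τ t : ℝ) ≤ √((t : ℝ) * (1 / Real.log t - 1 / (Real.log t) ^ 2)))
    (R : ℝ) :
    ∃ C : ℝ, ∀ (S : Ξ → ℕ → Set (Fin d)), Hogwild.IsFilterFamily f D S →
      ∀ (αs : ℕ → ℝ), (∀ t, 12 ≤ αs t ∧ αs t ≤ α) →
      ∀ (Ω : Type*) [MeasurableSpace Ω] (Pr : Measure Ω) [IsProbabilityMeasure Pr]
        (ξ : ℕ → Ω → Ξ) (u : ℕ → Ω → ℕ) (Sig : ℕ → ℕ → Ω → Set (Fin d))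
        (w what : ℕ → Ω → Hogwild.Vec d),
      Hogwild.IsRun Pr P f D S (fun t => αs t / (μ * ((t : ℝ) + 2 * (τ t : ℝ)))) τ
        ξ u Sig w what →
      ∫ ω, ‖w 0 ω - wstar‖ ^ 2 ∂Pr ≤ R →
      ∀ t : ℕ, 2 ≤ t →
        (Integrable (fun ω => ‖what (t + 1) ω - wstar‖ ^ 2) Pr ∧
          ∫ ω, ‖what (t + 1) ω - wstar‖ ^ 2 ∂Pr ≤
            4 * α ^ 2 * D * Hogwild.noise P f wstar / μ ^ 2 * (1 / (t : ℝ)) +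
              C * (1 / ((t : ℝ) * Real.log t))) ∧
        (Integrable (fun ω => ‖w (t + 1) ω - wstar‖ ^ 2) Pr ∧
          ∫ ω, ‖w (t + 1) ω - wstar‖ ^ 2 ∂Pr ≤
            4 * α ^ 2 * D * Hogwild.noise P f wstar / μ ^ 2 * (1 / (t : ℝ)) +
              C * (1 / ((t : ℝ) * Real.log t))) := by
  obtain ⟨C, hC⟩ := Hogwild.exists_rate_const L μ (Hogwild.noise P f wstar) R D τ α hμ
    Hogwild.noise_nonneg hτ_upper
  refine ⟨C, fun S hS αs hαs Ω _ Pr _ ξ u Sig w what h hR t ht => ?_⟩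
  have hLp := h.memLp hf_smooth hL hf_meas hf_int hN hD hS (t + 1)
  have hrec := h.isMomentRecursion hf_smooth hL hf_meas hf_int hN hD hS hμ hF hwstar
    (fun t => (Hogwild.stepSize_nonneg_and_le hμ (hαs t) t (τ t)).1) hR
  have hrate := hC αs hαs _ _ _ hrec t ht
  exact ⟨⟨hLp.2.integrable_sq_norm_sub_const wstar, hrate.1⟩,
    ⟨hLp.1.integrable_sq_norm_sub_const wstar, hrate.2⟩⟩
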